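/- Let $(M,g,J)$ be a connected Kähler manifold ($g$ Riemannian, with Levi-Civita connection $\nabla$) of real dimension $2m\ge 4$. Write $X^\flat=g(X,\cdot)$, and call an endomorphism field $A$ of $TM$ hermitian if it is smooth, $g$-symmetric and commutes with $J$. Let $\mathrm{Sol}(g,J)$ be the real vector space of hermitian endomorphism fields $A$ for which there is a smooth vector field $\Lambda$ with $$\nabla_X A = X^\flat\otimes\Lambda+\Lambda^\flat\otimes X+(JX)^\flat\otimes J\Lambda+(J\Lambda)^\flat\otimes JX\qquad\text{for all } X, \tag{1}$$ and let $D(g,J)=\dim\mathrm{Sol}(g,J)$ be the mobility. For $B\in\mathbb R$ say that $(g,J)$ is $C_{\mathbb C}(B)$ if there are a hermitian $A$, a smooth vector field $\Lambda$ that is not identically zero, and a smooth function $\mu$ satisfying (1) together with $$\nabla\Lambda=\mu\,\mathrm{Id}+BA,\qquad d\mu=2B\,\Lambda^\flat .$$ For $A\in\mathrm{Sol}(g,J)$, listing the eigenvalues of $A_x$ at each point $x\in M$ in decreasing order with multiplicity gives functions $\xi_1\ge\xi_2\ge\dots$ on $M$; the constant (nonconstant) eigenvalues of $A$ are the distinct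 functions among these that are constant (nonconstant) on $M$. Suppose that $(M,g,J)$ is $C_{\mathbb C}(B)$ for some $B\in\mathbb R$ and that there exists $A\in\mathrm{Sol}(g,J)$ such that either the number of nonconstant eigenvalues of $A$ is at least $2$, or the number of constant eigenvalues of $A$ is at least $3$. Then $D(g,J)\ge 3$. -/

import Mathlib

open scoped Manifold ContDiff Bundle
open Bundle FiberBundle VectorField

set_option linter.unusedSectionVars false

noncomputable section

namespace KahlerMobility

section LeviCivita

variable {E : Type*} [NormedAddCommGroup E] [NormedSpace ℝ E]
  {M : Type*} [TopologicalSpace M] [ChartedSpace E M] [IsManifold 𝓘(ℝ, E) ∞ M]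
  [RiemannianBundle (fun x : M => TangentSpace 𝓘(ℝ, E) x)]

/-- The right-hand side of the Koszul formula,
`X⟨Y,Z⟩ + Y⟨X,Z⟩ - Z⟨X,Y⟩ + ⟨[X,Y],Z⟩ - ⟨[X,Z],Y⟩ - ⟨[Y,Z],X⟩`. -/
def koszul (X Y Z : Π x : M, TangentSpace 𝓘(ℝ, E) x) (x : M) : ℝ :=
  mvfderiv 𝓘(ℝ, E) (fun y => inner ℝ (Y y) (Z y)) x (X x)
    + mvfderiv 𝓘(ℝ, E) (fun y => inner ℝ (X y) (Z y)) x (Y x)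
    - mvfderiv 𝓘(ℝ, E) (fun y => inner ℝ (X y) (Y y)) x (Z x)
    + inner ℝ (mlieBracket 𝓘(ℝ, E) X Y x) (Z x)
    - inner ℝ (mlieBracket 𝓘(ℝ, E) X Z x) (Y x)
    - inner ℝ (mlieBracket 𝓘(ℝ, E) Y Z x) (X x)

variable [IsContMDiffRiemannianBundle 𝓘(ℝ, E) ∞ E (fun x : M => TangentSpace 𝓘(ℝ, E) x)]

lemma mdiff_inner {X Y : Π x : M, TangentSpace 𝓘(ℝ, E) x} {x : M}
    (hX : MDiffAt (T% X) x) (hY : MDiffAt (T% Y) x) :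
    MDifferentiableAt 𝓘(ℝ, E) 𝓘(ℝ, ℝ) (fun y => inner ℝ (X y) (Y y)) x :=
  MDifferentiableAt.inner_bundle (IB := 𝓘(ℝ, E)) (F := E)
    (E := fun x : M => TangentSpace 𝓘(ℝ, E) x) hX hY

lemma dinner_smul_left {X Y : Π x : M, TangentSpace 𝓘(ℝ, E) x} {x : M} {f : M → ℝ}
    (hf : MDiffAt f x) (hX : MDiffAt (T% X) x) (hY : MDiffAt (T% Y) x) :
    mvfderiv 𝓘(ℝ, E) (fun y => inner ℝ ((f • X) y) (Y y)) x =
      f x • mvfderiv 𝓘(ℝ, E) (fun y => inner ℝ (X y) (Y y)) x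
        + (inner ℝ (X x) (Y x) : ℝ) • mvfderiv 𝓘(ℝ, E) f x := by
  rw [← mvfderiv_fun_mul hf (mdiff_inner hX hY)]
  congr 1
  ext y
  exact real_inner_smul_left _ _ _

lemma dinner_comm (X Y : Π x : M, TangentSpace 𝓘(ℝ, E) x) (x : M) :
    mvfderiv 𝓘(ℝ, E) (fun y => inner ℝ (X y) (Y y)) x =
      mvfderiv 𝓘(ℝ, E) (fun y => inner ℝ (Y y) (X y)) x := by
  congr 1
  ext y
  exact real_inner_comm _ _

lemma dinner_smul_right {X Y : Π x : M, TangentSpace 𝓘(ℝ, E) x} {x : M} {f : M → ℝ}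
    (hf : MDiffAt f x) (hX : MDiffAt (T% X) x) (hY : MDiffAt (T% Y) x) :
    mvfderiv 𝓘(ℝ, E) (fun y => inner ℝ (X y) ((f • Y) y)) x =
      f x • mvfderiv 𝓘(ℝ, E) (fun y => inner ℝ (X y) (Y y)) x
        + (inner ℝ (X x) (Y x) : ℝ) • mvfderiv 𝓘(ℝ, E) f x := by
  rw [dinner_comm, dinner_smul_left hf hY hX, dinner_comm X Y, real_inner_comm]

lemma dinner_add_left {X X' Y : Π x : M, TangentSpace 𝓘(ℝ, E) x} {x : M}
    (hX : MDiffAt (T% X) x) (hX' : MDiffAt (T% X') x) (hY : MDiffAt (T% Y) x) :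
    mvfderiv 𝓘(ℝ, E) (fun y => inner ℝ ((X + X') y) (Y y)) x =
      mvfderiv 𝓘(ℝ, E) (fun y => inner ℝ (X y) (Y y)) x
        + mvfderiv 𝓘(ℝ, E) (fun y => inner ℝ (X' y) (Y y)) x := by
  rw [← mvfderiv_fun_add (mdiff_inner hX hY) (mdiff_inner hX' hY)]
  congr 1
  ext y
  exact inner_add_left _ _ _

lemma dinner_add_right {X Y Y' : Π x : M, TangentSpace 𝓘(ℝ, E) x} {x : M}
    (hX : MDiffAt (T% X) x) (hY : MDiffAt (T% Y) x) (hY' : MDiffAt (T% Y') x) :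
    mvfderiv 𝓘(ℝ, E) (fun y => inner ℝ (X y) ((Y + Y') y)) x =
      mvfderiv 𝓘(ℝ, E) (fun y => inner ℝ (X y) (Y y)) x
        + mvfderiv 𝓘(ℝ, E) (fun y => inner ℝ (X y) (Y' y)) x := by
  rw [dinner_comm, dinner_add_left hY hY' hX, dinner_comm X Y, dinner_comm X Y']

variable [FiniteDimensional ℝ E]

lemma koszul_tensorial_left {Y Z : Π x : M, TangentSpace 𝓘(ℝ, E) x} {x : M}
    (hY : MDiffAt (T% Y) x) (hZ : MDiffAt (T% Z) x) :
    TensorialAt 𝓘(ℝ, E) E (fun X => koszul X Y Z x) x where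
  smul {f X} hf hX := by
    simp only [koszul]
    rw [dinner_smul_left hf hX hZ, dinner_smul_left hf hX hY, mlieBracket_smul_left hf hX,
      mlieBracket_smul_left hf hX]
    simp [inner_add_left, inner_smul_left, inner_smul_right]
    ring
  add {X X'} hX hX' := by
    simp only [koszul]
    rw [dinner_add_left hX hX' hZ, dinner_add_left hX hX' hY, mlieBracket_add_left hX hX',
      mlieBracket_add_left hX hX']
    simp [inner_add_left, inner_add_right]
    ring

lemma koszul_tensorial_right {X Y : Π x : M, TangentSpace 𝓘(ℝ, E) x} {x : M}
    (hX : MDiffAt (T% X) x) (hY : MDiffAt (T% Y) x) :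
    TensorialAt 𝓘(ℝ, E) E (fun Z => koszul X Y Z x) x where
  smul {f Z} hf hZ := by
    simp only [koszul]
    rw [dinner_smul_right hf hY hZ, dinner_smul_right hf hX hZ, mlieBracket_smul_right hf hZ,
      mlieBracket_smul_right hf hZ]
    simp [inner_add_left, inner_smul_left, inner_smul_right, real_inner_comm]
    ring
  add {Z Z'} hZ hZ' := by
    simp only [koszul]
    rw [dinner_add_right hY hZ hZ', dinner_add_right hX hZ hZ', mlieBracket_add_right hZ hZ',
      mlieBracket_add_right hZ hZ']
    simp [inner_add_left, inner_add_right]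
    ring

lemma koszul_smul_mid {X Y Z : Π x : M, TangentSpace 𝓘(ℝ, E) x} {x : M} {f : M → ℝ}
    (hf : MDiffAt f x)
    (hX : MDiffAt (T% X) x) (hY : MDiffAt (T% Y) x) (hZ : MDiffAt (T% Z) x) :
    koszul X (f • Y) Z x =
      f x * koszul X Y Z x + 2 * (mvfderiv 𝓘(ℝ, E) f x (X x) * inner ℝ (Y x) (Z x)) := by
  simp only [koszul]
  rw [dinner_smul_left hf hY hZ, dinner_smul_right hf hX hY, mlieBracket_smul_right hf hY,
    mlieBracket_smul_left hf hY]
  simp [inner_add_left, inner_smul_left, inner_smul_right, real_inner_comm]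
  ring

lemma koszul_add_mid {X Y Y' Z : Π x : M, TangentSpace 𝓘(ℝ, E) x} {x : M}
    (hX : MDiffAt (T% X) x) (hY : MDiffAt (T% Y) x) (hY' : MDiffAt (T% Y') x)
    (hZ : MDiffAt (T% Z) x) :
    koszul X (Y + Y') Z x = koszul X Y Z x + koszul X Y' Z x := by
  simp only [koszul]
  rw [dinner_add_left hY hY' hZ, dinner_add_right hX hY hY', mlieBracket_add_right hY hY',
    mlieBracket_add_left hY hY']
  simp [inner_add_left, inner_add_right]
  ring

instance instFinDimTangent (x : M) : FiniteDimensional ℝ (TangentSpace 𝓘(ℝ, E) x) :=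
  inferInstanceAs (FiniteDimensional ℝ E)

/-- For a vector field `Y` differentiable at `x`, the Koszul expression as a bilinear form in the
values at `x` of the other two vector fields. -/
def koszulForm (Y : Π x : M, TangentSpace 𝓘(ℝ, E) x) (x : M) (hY : MDiffAt (T% Y) x) :
    TangentSpace 𝓘(ℝ, E) x →L[ℝ] TangentSpace 𝓘(ℝ, E) x →L[ℝ] ℝ :=
  TensorialAt.mkHom₂ (I := 𝓘(ℝ, E)) (F := E) (F' := E) (fun X Z => koszul X Y Z x) x
    (fun _ hZ => koszul_tensorial_left hY hZ) (fun _ hX => koszul_tensorial_right hX hY)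

lemma koszulForm_apply {X Y Z : Π x : M, TangentSpace 𝓘(ℝ, E) x} {x : M}
    (hX : MDiffAt (T% X) x) (hY : MDiffAt (T% Y) x) (hZ : MDiffAt (T% Z) x) :
    koszulForm Y x hY (X x) (Z x) = koszul X Y Z x :=
  TensorialAt.mkHom₂_apply (I := 𝓘(ℝ, E)) (F := E) (F' := E)
    (fun _ hZ => koszul_tensorial_left hY hZ) (fun _ hX => koszul_tensorial_right hX hY) hX hZ

open scoped Classical in
/-- `∇Y` at `x`, obtained from the Koszul formula by Riesz duality (and `0` by convention where `Y` is
not differentiable). -/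
def leviCivitaFun (Y : Π x : M, TangentSpace 𝓘(ℝ, E) x) (x : M) :
    TangentSpace 𝓘(ℝ, E) x →L[ℝ] TangentSpace 𝓘(ℝ, E) x :=
  if hY : MDiffAt (T% Y) x then
    LinearMap.toContinuousLinearMap
      { toFun := fun v =>
          (InnerProductSpace.toDual ℝ (TangentSpace 𝓘(ℝ, E) x)).symm
            ((1 / 2 : ℝ) • koszulForm Y x hY v)
        map_add' := fun v w => by simp
        map_smul' := fun c v => by simp [smul_comm c] }
  else 0

lemma leviCivitaFun_spec {X Y Z : Π x : M, TangentSpace 𝓘(ℝ, E) x} {x : M}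
    (hX : MDiffAt (T% X) x) (hY : MDiffAt (T% Y) x) (hZ : MDiffAt (T% Z) x) :
    2 * inner ℝ (leviCivitaFun Y x (X x)) (Z x) = koszul X Y Z x := by
  rw [← koszulForm_apply hX hY hZ, leviCivitaFun, dif_pos hY]
  have h := InnerProductSpace.toDual_symm_apply (𝕜 := ℝ) (x := Z x)
    (y := (1 / 2 : ℝ) • koszulForm Y x hY (X x))
  change 2 * inner ℝ ((InnerProductSpace.toDual ℝ (TangentSpace 𝓘(ℝ, E) x)).symm
    ((1 / 2 : ℝ) • koszulForm Y x hY (X x))) (Z x) = _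
  refine (congrArg (fun t : ℝ => 2 * t) h).trans ?_
  simp

lemma ext_inner_extend {x : M} {S T : TangentSpace 𝓘(ℝ, E) x →L[ℝ] TangentSpace 𝓘(ℝ, E) x}
    (h : ∀ X Z : Π x : M, TangentSpace 𝓘(ℝ, E) x, MDiffAt (T% X) x → MDiffAt (T% Z) x →
      2 * inner ℝ (S (X x)) (Z x) = (2 * inner ℝ (T (X x)) (Z x) : ℝ)) : S = T := by
  ext v
  refine ext_inner_right ℝ fun w => ?_
  have := h (extend E v) (extend E w) (mdifferentiableAt_extend ..) (mdifferentiableAt_extend ..)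
  simpa using this

variable (E M) in
/-- The Levi-Civita connection of the Riemannian metric on the tangent bundle of `M`;
`leviCivita E M Y x v` is `(∇_v Y)(x)`. -/
def leviCivita : CovariantDerivative 𝓘(ℝ, E) E (fun x : M => TangentSpace 𝓘(ℝ, E) x) where
  toFun := leviCivitaFun
  isCovariantDerivativeOnUniv :=
    { add := fun {Y Y' x} hY hY' _ => by
        refine ext_inner_extend fun X Z hX hZ => ?_
        rw [leviCivitaFun_spec hX (mdifferentiableAt_add_section hY hY') hZ,
          koszul_add_mid hX hY hY' hZ, _root_.add_apply, inner_add_left, mul_add,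
          leviCivitaFun_spec hX hY hZ, leviCivitaFun_spec hX hY' hZ]
      leibniz := fun {Y f x} hY hf _ => by
        refine ext_inner_extend fun X Z hX hZ => ?_
        rw [leviCivitaFun_spec hX (hf.smul_section hY) hZ,
          koszul_smul_mid hf hX hY hZ, _root_.add_apply, inner_add_left, mul_add,
          _root_.smul_apply, real_inner_smul_left,
          ContinuousLinearMap.smulRight_apply, real_inner_smul_left,
          ← leviCivitaFun_spec hX hY hZ]
        ring }

lemma leviCivita_koszul {X Y Z : Π x : M, TangentSpace 𝓘(ℝ, E) x} {x : M}
    (hX : MDiffAt (T% X) x) (hY : MDiffAt (T% Y) x) (hZ : MDiffAt (T% Z) x) :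
    2 * inner ℝ (leviCivita E M Y x (X x)) (Z x) = koszul X Y Z x :=
  leviCivitaFun_spec hX hY hZ

/-- The Levi-Civita connection is torsion-free. -/
theorem leviCivita_torsion : (leviCivita E M).torsion = 0 := by
  rw [CovariantDerivative.torsion_eq_zero_iff]
  intro X Y x hX hY
  refine ext_inner_right ℝ fun w => ?_
  have hw : MDiffAt (T% (extend E w : Π x : M, TangentSpace 𝓘(ℝ, E) x)) x :=
    mdifferentiableAt_extend ..
  have h1 := leviCivita_koszul hX hY hw
  have h2 := leviCivita_koszul hY hX hw
  rw [inner_sub_left]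
  simp only [koszul, extend_apply_self] at h1 h2
  rw [dinner_comm Y X, mlieBracket_swap_apply (V := Y) (W := X), inner_neg_left] at h2
  linarith

/-- The Levi-Civita connection preserves the metric. -/
theorem leviCivita_metric {X Y Z : Π x : M, TangentSpace 𝓘(ℝ, E) x} {x : M}
    (hX : MDiffAt (T% X) x) (hY : MDiffAt (T% Y) x) (hZ : MDiffAt (T% Z) x) :
    mvfderiv 𝓘(ℝ, E) (fun y => inner ℝ (Y y) (Z y)) x (X x) =
      inner ℝ (leviCivita E M Y x (X x)) (Z x) + inner ℝ (Y x) (leviCivita E M Z x (X x)) := by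
  have h1 := leviCivita_koszul hX hY hZ
  have h2 := leviCivita_koszul hX hZ hY
  simp only [koszul] at h1 h2
  rw [dinner_comm Z Y, mlieBracket_swap_apply (V := Z) (W := Y), inner_neg_left] at h2
  rw [real_inner_comm _ (Y x)]
  linarith

end LeviCivita

variable (E : Type*) [NormedAddCommGroup E] [NormedSpace ℝ E]
  (M : Type*) [TopologicalSpace M] [ChartedSpace E M] [IsManifold 𝓘(ℝ, E) ∞ M]

/-- Vector fields on `M` (not necessarily smooth). -/
abbrev VField : Type _ := Π x : M, TangentSpace 𝓘(ℝ, E) x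

/-- Fields of endomorphisms of the tangent spaces of `M` (not necessarily smooth). -/
abbrev EndField : Type _ := Π x : M, TangentSpace 𝓘(ℝ, E) x →L[ℝ] TangentSpace 𝓘(ℝ, E) x

variable {E M} in
/-- The vector field `X` is smooth. -/
def SmoothV (X : VField E M) : Prop :=
  ContMDiff 𝓘(ℝ, E) (𝓘(ℝ, E).prod 𝓘(ℝ, E)) ∞
    (fun x => TotalSpace.mk' E (E := fun x : M => TangentSpace 𝓘(ℝ, E) x) x (X x))

variable {E M} in
/-- The field of endomorphisms `A` is smooth. -/
def SmoothEnd (A : EndField E M) : Prop :=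
  ContMDiff 𝓘(ℝ, E) (𝓘(ℝ, E).prod 𝓘(ℝ, E →L[ℝ] E)) ∞
    (fun x => TotalSpace.mk' (E →L[ℝ] E)
      (E := fun x : M => TangentSpace 𝓘(ℝ, E) x →L[ℝ] TangentSpace 𝓘(ℝ, E) x) x (A x))

variable [RiemannianBundle (fun x : M => TangentSpace 𝓘(ℝ, E) x)]
  [IsContMDiffRiemannianBundle 𝓘(ℝ, E) ∞ E (fun x : M => TangentSpace 𝓘(ℝ, E) x)]
  [FiniteDimensional ℝ E]

variable {E M} in
/-- The covariant derivative of an endomorphism field `A`, applied to a vector field `Y`: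
`(∇_v A)(Y) = ∇_v (A Y) - A (∇_v Y)` at `x`. -/
def covDerivEnd (A : EndField E M) (Y : VField E M) (x : M)
    (v : TangentSpace 𝓘(ℝ, E) x) : TangentSpace 𝓘(ℝ, E) x :=
  leviCivita E M (fun y => A y (Y y)) x v - A x (leviCivita E M Y x v)

variable {E M} in
lemma mdiff_end_apply {A : EndField E M} (hA : SmoothEnd A) {Y : VField E M} {x : M}
    (hY : MDiffAt (T% Y) x) :
    MDiffAt (T% (fun y => A y (Y y) : VField E M)) x :=
  MDifferentiableAt.clm_bundle_apply (F₁ := E) (F₂ := E)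
    (E₁ := fun x : M => TangentSpace 𝓘(ℝ, E) x) (E₂ := fun x : M => TangentSpace 𝓘(ℝ, E) x)
    (hA.mdifferentiable (by simp) x) hY

variable {E M} in
lemma covDerivEnd_add {A A' : EndField E M} (hA : SmoothEnd A) (hA' : SmoothEnd A')
    {Y : VField E M} {x : M} (v : TangentSpace 𝓘(ℝ, E) x) (hY : MDiffAt (T% Y) x) :
    covDerivEnd (A + A') Y x v = covDerivEnd A Y x v + covDerivEnd A' Y x v := by
  have h : leviCivita E M (fun y => (A + A') y (Y y)) x
      = leviCivita E M (fun y => A y (Y y)) x + leviCivita E M (fun y => A' y (Y y)) x :=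
    (leviCivita E M).isCovariantDerivativeOn.add (mdiff_end_apply hA hY) (mdiff_end_apply hA' hY)
  unfold covDerivEnd
  rw [h]
  simp only [Pi.add_apply, _root_.add_apply]
  abel

variable {E M} in
lemma covDerivEnd_smul (c : ℝ) {A : EndField E M} (hA : SmoothEnd A)
    {Y : VField E M} {x : M} (v : TangentSpace 𝓘(ℝ, E) x) (hY : MDiffAt (T% Y) x) :
    covDerivEnd (c • A) Y x v = c • covDerivEnd A Y x v := by
  have h : leviCivita E M (fun y => (c • A) y (Y y)) x
      = c • leviCivita E M (fun y => A y (Y y)) x :=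
    (leviCivita E M).isCovariantDerivativeOn.smul_const c (mdiff_end_apply hA hY)
  unfold covDerivEnd
  rw [h]
  simp only [Pi.smul_apply, _root_.smul_apply, smul_sub]

/-- A Kähler structure on a Riemannian manifold: a smooth almost complex structure `J` which is
orthogonal for the metric and parallel for the Levi-Civita connection (so that `J` is integrable
and the form `g(J·,·)` is closed). -/
structure KahlerStructure where
  /-- The complex structure. -/
  J : EndField E M
  smooth_J : SmoothEnd J
  J_sq : ∀ (x : M) (v : TangentSpace 𝓘(ℝ, E) x), J x (J x v) = -v
  inner_J : ∀ (x : M) (v w : TangentSpace 𝓘(ℝ, E) x), inner ℝ (J x v) (J x w) = inner ℝ v w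
  J_parallel : ∀ (Y : VField E M) (x : M) (v : TangentSpace 𝓘(ℝ, E) x),
    MDiffAt (T% Y) x → covDerivEnd J Y x v = 0

namespace KahlerStructure

variable {E M} (K : KahlerStructure E M)

/-- `A` is a hermitian endomorphism field: smooth, symmetric for the metric and commuting with `J`. -/
def IsHermitian (A : EndField E M) : Prop :=
  SmoothEnd A ∧
  (∀ (x : M) (v w : TangentSpace 𝓘(ℝ, E) x), inner ℝ (A x v) w = inner ℝ v (A x w)) ∧
  ∀ (x : M) (v : TangentSpace 𝓘(ℝ, E) x), A x (K.J x v) = K.J x (A x v)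

/-- The main equation of c-projective geometry,
`∇_X A = X♭ ⊗ Λ + Λ♭ ⊗ X + (JX)♭ ⊗ JΛ + (JΛ)♭ ⊗ JX`. -/
def MainEq (A : EndField E M) (Λ : VField E M) : Prop :=
  ∀ (Y : VField E M) (x : M) (v : TangentSpace 𝓘(ℝ, E) x),
    MDiffAt (T% Y) x →
      covDerivEnd A Y x v =
        (inner ℝ v (Y x) : ℝ) • Λ x + (inner ℝ (Λ x) (Y x) : ℝ) • v
          + (inner ℝ (K.J x v) (Y x) : ℝ) • K.J x (Λ x)
          + (inner ℝ (K.J x (Λ x)) (Y x) : ℝ) • K.J x v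

/-- The real vector space `Sol(g, J)` of hermitian endomorphism fields `A` satisfying the main
equation for some smooth vector field `Λ`. -/
def Sol : Submodule ℝ (EndField E M) where
  carrier := {A | K.IsHermitian A ∧ ∃ Λ : VField E M, SmoothV Λ ∧ K.MainEq A Λ}
  zero_mem' := by
    have h0 : SmoothEnd (0 : EndField E M) :=
      contMDiff_zeroSection ℝ (fun x : M => TangentSpace 𝓘(ℝ, E) x →L[ℝ] TangentSpace 𝓘(ℝ, E) x)
    have h0' : SmoothV (0 : VField E M) :=
      contMDiff_zeroSection ℝ (fun x : M => TangentSpace 𝓘(ℝ, E) x)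
    refine ⟨⟨h0, fun x v w => ?_, fun x v => ?_⟩, 0, h0', fun Y x v hY => ?_⟩
    · simp
    · simp
    · have h := covDerivEnd_smul 0 h0 v hY
      rw [smul_zero, zero_smul] at h
      rw [h]
      simp
  add_mem' := by
    rintro A A' ⟨⟨h0, h1, h2⟩, Λ, hΛ, h3⟩ ⟨⟨h0', h1', h2'⟩, Λ', hΛ', h3'⟩
    refine ⟨⟨ContMDiff.add_section h0 h0', fun x v w => ?_, fun x v => ?_⟩, Λ + Λ',
      ContMDiff.add_section hΛ hΛ', fun Y x v hY => ?_⟩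
    · simp [inner_add_left, inner_add_right, h1, h1']
    · simp [h2, h2']
    · rw [covDerivEnd_add h0 h0' v hY, h3 Y x v hY, h3' Y x v hY]
      simp only [Pi.add_apply, map_add, inner_add_left]
      module
  smul_mem' := by
    rintro c A ⟨⟨h0, h1, h2⟩, Λ, hΛ, h3⟩
    refine ⟨⟨ContMDiff.const_smul_section h0, fun x v w => ?_, fun x v => ?_⟩, c • Λ,
      ContMDiff.const_smul_section hΛ, fun Y x v hY => ?_⟩
    · simp [real_inner_smul_left, real_inner_smul_right, h1]
    · simp [h2]
    · rw [covDerivEnd_smul c h0 v hY, h3 Y x v hY]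
      simp only [Pi.smul_apply, map_smul, real_inner_smul_left]
      module

/-- The mobility of a Kähler manifold: the dimension of `Sol`. -/
def mobility : Cardinal := Module.rank ℝ K.Sol

/-- The property `C_ℂ(B)`: there is a solution `(A, Λ, μ)`, with `A` hermitian and `Λ` not identically
zero, of the main equation together with `∇Λ = μ Id + B A` and `dμ = 2 B Λ♭`. -/
def IsCC (B : ℝ) : Prop :=
  ∃ (A : EndField E M) (Λ : VField E M) (μ : M → ℝ),
    K.IsHermitian A ∧ SmoothV Λ ∧ ContMDiff 𝓘(ℝ, E) 𝓘(ℝ, ℝ) ∞ μ ∧ K.MainEq A Λ ∧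
      (∀ (x : M) (v : TangentSpace 𝓘(ℝ, E) x),
        leviCivita E M Λ x v = μ x • v + B • A x v) ∧
      (∀ (x : M) (v : TangentSpace 𝓘(ℝ, E) x),
        mvfderiv 𝓘(ℝ, E) μ x v = 2 * B * inner ℝ (Λ x) v) ∧
      ∃ x : M, Λ x ≠ 0

variable {K} in
/-- The eigenvalues of `A ∈ Sol` as functions on `M`: at each point `x` the eigenvalues of the
symmetric endomorphism `A x` are listed in decreasing order and with (real) multiplicity, and
`eigenvalueFun A i` is the function sending `x` to the `i`-th entry of the list. -/
def eigenvalueFun (A : K.Sol) (i : Fin (Module.finrank ℝ E)) (x : M) : ℝ :=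
  LinearMap.IsSymmetric.eigenvalues
    (T := ((A : EndField E M) x : TangentSpace 𝓘(ℝ, E) x →ₗ[ℝ] TangentSpace 𝓘(ℝ, E) x))
    (A.2.1.2.1 x) (n := Module.finrank ℝ E) rfl i

variable {K} in
/-- The number of distinct eigenvalue functions of `A` which are not constant on `M`. -/
def numNonconstEigenvalues (A : K.Sol) : ℕ :=
  Set.ncard {ξ : M → ℝ | (∃ i, ξ = eigenvalueFun A i) ∧ ¬ ∃ c : ℝ, ∀ x, ξ x = c}

variable {K} in
/-- The number of distinct eigenvalue functions of `A` which are constant on `M`. -/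
def numConstEigenvalues (A : K.Sol) : ℕ :=
  Set.ncard {ξ : M → ℝ | (∃ i, ξ = eigenvalueFun A i) ∧ ∃ c : ℝ, ∀ x, ξ x = c}

end KahlerStructure

end KahlerMobility

end

/-! Suppose `K.mobility` is at most two. The identity solves the main equation with vector field
`0`, and the solution `A₀` given by $C_{\mathbb C}(B)$ has a vector field that is not identically
zero, so these two span `Sol`. Every `A` in `Sol` is therefore a multiple of the identity or of the
form $a\,\mathrm{Id}+bA_0$ with $b\ne0$. In the second case it solves the same closed system, with
the same `B`, a vector field Λ that is not identically zero, and a new μ.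

The key point (`IsSolution.mainEq_quadraticField`) is that the closed system makes
$BA^2-\Lambda^\flat\otimes\Lambda-(J\Lambda)^\flat\otimes J\Lambda$ another element of `Sol`, with
vector field $BA\Lambda-\mu\Lambda$. It must depend linearly on `Id` and `A`, so with
$P(t)=Bt^2-pt-q$ one gets $P(A)=\Lambda^\flat\otimes\Lambda+(J\Lambda)^\flat\otimes J\Lambda$ and
$BA\Lambda=(p+\mu)\Lambda$. Hence Λ and JΛ share an eigenvalue ρ, with $P(\rho)=|\Lambda|^2$, and
every eigenvalue other than ρ is a root of `P`.

So the spectrum consists of ρ, twice, and of at most two constants. To turn this into a statement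
about the ordered eigenvalue functions, the multiplicities of the constants are shown not to depend
on the point (continuity of the trace, connectedness), and ρ is shown not to cross a root, because
$P(\rho)\ge0$. The delicate case is a double root with $B>0$, which Grönwall uniqueness settles. If
$B\ne0$, then $d\rho=2\Lambda^\flat$ and ρ is not constant; if $B=0$, there is only one root. Either
way there is at most one nonconstant eigenvalue and there are at most two constant ones. -/

namespace KahlerMobility

/-! ### Smoothness and trace of endomorphism fields; Grönwall uniqueness on a manifold. -/

section Analysis

variable {E : Type*} [NormedAddCommGroup E] [NormedSpace ℝ E]
  {M : Type*} [TopologicalSpace M] [ChartedSpace E M] [IsManifold 𝓘(ℝ, E) ∞ M]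

/-- A field of endomorphisms is smooth if it maps local smooth vector fields to such. -/
lemma smoothEnd_of_apply [FiniteDimensional ℝ E] {A : EndField E M}
    (h : ∀ (x : M) (Y : VField E M),
      ContMDiffAt 𝓘(ℝ, E) (𝓘(ℝ, E).prod 𝓘(ℝ, E)) ∞
        (fun y => TotalSpace.mk' E (E := fun x : M => TangentSpace 𝓘(ℝ, E) x) y (Y y)) x →
      ContMDiffAt 𝓘(ℝ, E) (𝓘(ℝ, E).prod 𝓘(ℝ, E)) ∞
        (fun y => TotalSpace.mk' E (E := fun x : M => TangentSpace 𝓘(ℝ, E) x) y (A y (Y y))) x) :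
    SmoothEnd A := by
  intro x
  refine (contMDiffAt_hom_bundle _).2 ⟨contMDiffAt_id, ?_⟩
  set e := trivializationAt E (fun x : M => TangentSpace 𝓘(ℝ, E) x) x with he
  set b := Module.finBasis ℝ E
  -- In the trivialization at `x`, the column `w` of the matrix of `A` is the image under `A` of the
  -- field with constant coordinate `w`. That field is controlled only near `x`, which is why the
  -- hypothesis is pointwise in `ContMDiffAt`.
  have key : ∀ w : E, ContMDiffAt 𝓘(ℝ, E) 𝓘(ℝ, E) ∞
      (fun y => ContinuousLinearMap.inCoordinates E (fun x : M => TangentSpace 𝓘(ℝ, E) x) E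
        (fun x : M => TangentSpace 𝓘(ℝ, E) x) x y x y (A y) w) x := by
    intro w
    have h1 : ContMDiffAt 𝓘(ℝ, E) (𝓘(ℝ, E).prod 𝓘(ℝ, E)) ∞
        (fun y => TotalSpace.mk' E (E := fun x : M => TangentSpace 𝓘(ℝ, E) x) y
          (e.symmL ℝ y w)) x := by
      have := e.contMDiffAt_symmL (IB := 𝓘(ℝ, E)) (n := ∞)
        (FiberBundle.mem_baseSet_trivializationAt E (fun x : M => TangentSpace 𝓘(ℝ, E) x) x)
      exact ContMDiffAt.clm_bundle_apply (F₁ := E) (F₂ := E) (E₁ := fun _ : M => E)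
        (E₂ := fun x : M => TangentSpace 𝓘(ℝ, E) x) (b := id) (v := fun _ => w) this
        (contMDiffAt_totalSpace.2 ⟨contMDiffAt_id, contMDiffAt_const⟩)
    have h2 := (contMDiffAt_totalSpace.1 (h x _ h1)).2
    refine h2.congr_of_eventuallyEq ?_
    filter_upwards [e.open_baseSet.mem_nhds
      (FiberBundle.mem_baseSet_trivializationAt E (fun x : M => TangentSpace 𝓘(ℝ, E) x) x)]
      with y hy
    simp only [ContinuousLinearMap.inCoordinates, ContinuousLinearMap.comp_apply]
    exact e.continuousLinearMapAt_apply_of_mem ℝ hy _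
  have hsum : (fun y => ContinuousLinearMap.inCoordinates E (fun x : M => TangentSpace 𝓘(ℝ, E) x) E
        (fun x : M => TangentSpace 𝓘(ℝ, E) x) x y x y (A y)) = fun y => ∑ i,
        ContinuousLinearMap.smulRightL ℝ E E (LinearMap.toContinuousLinearMap (b.coord i))
        (ContinuousLinearMap.inCoordinates E (fun x : M => TangentSpace 𝓘(ℝ, E) x) E
        (fun x : M => TangentSpace 𝓘(ℝ, E) x) x y x y (A y) (b i)) := by
    funext y
    ext w
    conv_lhs => rw [← b.sum_repr w]
    simp only [map_sum, map_smul]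
    simp
  change ContMDiffAt 𝓘(ℝ, E) 𝓘(ℝ, E →L[ℝ] E) ∞ _ x
  rw [hsum]
  exact ContMDiffAt.sum fun i _ =>
    (ContinuousLinearMap.contMDiff _).contMDiffAt.comp x (key (b i))

/-- The trace is invariant under conjugation, so it can be read off in a local trivialization. This
is the only continuity of the spectrum needed later; the ordered eigenvalues are never shown to be
continuous separately. -/
lemma continuous_trace [FiniteDimensional ℝ E] {A : EndField E M} (hA : SmoothEnd A) :
    Continuous fun x : M =>
      LinearMap.trace ℝ (TangentSpace 𝓘(ℝ, E) x) (A x).toLinearMap := by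
  rw [continuous_iff_continuousAt]
  intro x
  have h1 := ((contMDiffAt_hom_bundle _).1 (hA x)).2.continuousAt
  have h2 : Continuous fun T : E →L[ℝ] E => LinearMap.trace ℝ E T.toLinearMap :=
    ((LinearMap.trace ℝ E).comp (ContinuousLinearMap.coeLM ℝ)).continuous_of_finiteDimensional
  refine (h2.continuousAt.comp h1).congr ?_
  set e := trivializationAt E (fun x : M => TangentSpace 𝓘(ℝ, E) x) x with he
  have hx := FiberBundle.mem_baseSet_trivializationAt E (fun x : M => TangentSpace 𝓘(ℝ, E) x) x
  filter_upwards [e.open_baseSet.mem_nhds hx] with y hy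
  rw [Function.comp_apply, ContinuousLinearMap.inCoordinates_eq hy hy]
  exact LinearMap.trace_conj' (A y).toLinearMap (e.continuousLinearEquivAt ℝ y hy).toLinearEquiv

variable [RiemannianBundle (fun x : M => TangentSpace 𝓘(ℝ, E) x)]
  [IsContMDiffRiemannianBundle 𝓘(ℝ, E) ∞ E (fun x : M => TangentSpace 𝓘(ℝ, E) x)]

/-- Along straight segments in a chart, the bound becomes a linear differential inequality in one
variable, and Grönwall applies. The constant `K` below bounds the differential of the inverse chart
near `x`. -/
lemma eventually_eq_zero_of_abs_mvfderiv_le {u : M → ℝ} (hu : MDiff u) {C : ℝ} (hC : 0 ≤ C)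
    (h : ∀ (x : M) (v : TangentSpace 𝓘(ℝ, E) x), |mvfderiv 𝓘(ℝ, E) u x v| ≤ C * |u x| * ‖v‖)
    {x : M} (hx : u x = 0) : ∀ᶠ y in nhds x, u y = 0 := by
  have : IsContinuousRiemannianBundle E (fun x : M => TangentSpace 𝓘(ℝ, E) x) := by
    have := IsContMDiffRiemannianBundle.exists_contMDiff (IB := 𝓘(ℝ, E)) (n := ∞) (F := E)
      (E := fun x : M => TangentSpace 𝓘(ℝ, E) x)
    obtain ⟨g, h1, h2⟩ := this
    exact ⟨g, h1.continuous, h2⟩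
  obtain ⟨K, hK, hb⟩ := eventually_norm_mfderivWithin_symm_extChartAt_lt 𝓘(ℝ, E) x
  rw [ModelWithCorners.range_eq_univ, nhdsWithin_univ] at hb
  set φ := extChartAt 𝓘(ℝ, E) x with hφ
  have hopen : φ.target ∈ nhds (φ x) := extChartAt_target_mem_nhds x
  obtain ⟨r, hr, hball⟩ := Metric.eventually_nhds_iff_ball.1 (hb.and hopen)
  have hnear : ∀ᶠ y in nhds x, φ y ∈ Metric.ball (φ x) r :=
    (continuousAt_extChartAt x).preimage_mem_nhds (Metric.ball_mem_nhds _ hr)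
  filter_upwards [hnear, extChartAt_source_mem_nhds (I := 𝓘(ℝ, E)) x] with y hy hys
  set w : E := φ y - φ x with hw
  set c : ℝ → E := fun t => φ x + t • w with hc
  have hcb : ∀ t ∈ Set.Icc (0 : ℝ) 1, c t ∈ Metric.ball (φ x) r := by
    intro t ht
    have : ‖t • w‖ ≤ ‖w‖ := by
      rw [norm_smul, Real.norm_eq_abs, abs_of_nonneg ht.1]
      exact mul_le_of_le_one_left (norm_nonneg _) ht.2
    rw [mem_ball_iff_norm] at hy ⊢
    simp only [hc, add_sub_cancel_left]
    exact this.trans_lt hy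
  have hcd : ∀ t, HasDerivAt c w t := fun t => by
    have := ((hasDerivAt_id t).smul_const w).const_add (φ x)
    rw [one_smul] at this
    exact this
  have hd : ∀ t ∈ Set.Icc (0 : ℝ) 1, ∃ d : ℝ, HasDerivAt (fun t => u (φ.symm (c t))) d t ∧
      ‖d‖ ≤ (C * K * ‖w‖) * ‖u (φ.symm (c t))‖ := by
    intro t ht
    obtain ⟨hK', htar⟩ := hball _ (hcb t ht)
    have hs : MDifferentiableAt 𝓘(ℝ, E) 𝓘(ℝ, E) φ.symm (c t) :=
      ((contMDiffOn_extChartAt_symm (I := 𝓘(ℝ, E)) (n := ∞) x).contMDiffAt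
        (extChartAt_target_mem_nhds' htar)).mdifferentiableAt (by simp)
    have hcm := (hu (φ.symm (c t))).comp (c t) hs
    have hfd := (mdifferentiableAt_iff_differentiableAt.1 hcm).hasFDerivAt
    refine ⟨_, hfd.comp_hasDerivAt t (hcd t), ?_⟩
    have e1 : fderiv ℝ (u ∘ φ.symm) (c t) w =
        mvfderiv 𝓘(ℝ, E) u (φ.symm (c t)) (mfderiv 𝓘(ℝ, E) 𝓘(ℝ, E) φ.symm (c t) w) := by
      rw [← mvfderiv_comp_apply (c t) (hu _) hs w, mvfderiv, mfderiv_eq_fderiv]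
      rfl
    rw [e1, Real.norm_eq_abs]
    refine (h _ _).trans ?_
    rw [mfderivWithin_univ] at hK'
    let := normedAddCommGroupTangentSpaceVectorSpace (c t)
    let := normedSpaceTangentSpaceVectorSpace (c t)
    have e2 := (mfderiv 𝓘(ℝ, E) 𝓘(ℝ, E) φ.symm (c t)).le_of_opNorm_le hK'.le w
    calc C * |u (φ.symm (c t))| * _ ≤ C * |u (φ.symm (c t))| * (K * ‖w‖) := by gcongr; exact e2
      _ = _ := by rw [Real.norm_eq_abs]; ring
  choose! d hd1 hd2 using hd
  have := eq_zero_of_abs_deriv_le_mul_abs_self_of_eq_zero_right (a := 0) (b := 1)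
    (f := fun t => u (φ.symm (c t))) (f' := d)
    (fun t ht => (hd1 t ht).continuousAt.continuousWithinAt)
    (fun t ht => (hd1 t (Set.Ico_subset_Icc_self ht)).hasDerivWithinAt)
    (by simp only [hc, zero_smul, add_zero, hφ, extChartAt_to_inv, hx])
    (fun t ht => hd2 t (Set.Ico_subset_Icc_self ht)) 1 (by simp)
  simpa [hc, hw, φ.left_inv hys, -extChartAt] using this

/-- Grönwall uniqueness on a connected manifold: a function whose differential is bounded by a
multiple of the function itself vanishes identically as soon as it vanishes at a point. -/
lemma eq_zero_of_abs_mvfderiv_le [PreconnectedSpace M] {u : M → ℝ} (hu : MDiff u)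
    {C : ℝ} (hC : 0 ≤ C)
    (h : ∀ (x : M) (v : TangentSpace 𝓘(ℝ, E) x), |mvfderiv 𝓘(ℝ, E) u x v| ≤ C * |u x| * ‖v‖)
    {x : M} (hx : u x = 0) (y : M) : u y = 0 := by
  have hclopen : IsClopen {z | u z = 0} :=
    ⟨isClosed_eq hu.continuous continuous_const, isOpen_iff_mem_nhds.2 fun z hz =>
      eventually_eq_zero_of_abs_mvfderiv_le hu hC h hz⟩
  have := hclopen.eq_univ ⟨x, hx⟩
  exact this.ge (Set.mem_univ y)

lemma eq_of_mvfderiv_eq_zero [PreconnectedSpace M] {u : M → ℝ} (hu : MDiff u)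
    (h : ∀ x, mvfderiv 𝓘(ℝ, E) u x = 0) (x y : M) : u x = u y := by
  have hd : MDiff (fun z => u z - u y) := fun z => (hu z).sub mdifferentiableAt_const
  refine sub_eq_zero.1 (eq_zero_of_abs_mvfderiv_le (C := 0) hd le_rfl (fun z v => ?_) (x := y)
    (sub_self _) x)
  have := mvfderiv_sub (hu z) (mdifferentiableAt_const (I := 𝓘(ℝ, E)) (c := u y))
  have h2 : mvfderiv 𝓘(ℝ, E) (fun z => u z - u y) z = 0 := by
    refine this.trans ?_
    rw [h z, mvfderiv_const, sub_zero]
  rw [h2]; simp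

end Analysis
end KahlerMobility
namespace KahlerMobility

/-! ### Recovering a decreasing family from its multiset of values. -/

section Multisets

lemma exists_eq_replicate_add {α : Type*} {a c : α} (s : Multiset α)
    (h : ∀ t ∈ s, t = a ∨ t = c) :
    ∃ j ≤ s.card, s = Multiset.replicate j a + Multiset.replicate (s.card - j) c := by
  induction s using Multiset.induction with
  | empty => exact ⟨0, by simp, by simp⟩
  | cons t s ih =>
    obtain ⟨j, hj, hs⟩ := ih fun t ht => h t (Multiset.mem_cons_of_mem ht)
    rcases h t (Multiset.mem_cons_self t s) with rfl | rfl
    · refine ⟨j + 1, by simpa using hj, ?_⟩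
      rw [Multiset.card_cons, Nat.add_sub_add_right, Multiset.replicate_succ, Multiset.cons_add,
        ← hs]
    · refine ⟨j, by rw [Multiset.card_cons]; omega, ?_⟩
      rw [Multiset.card_cons, Nat.succ_sub hj, Multiset.replicate_succ, Multiset.add_cons, ← hs]

/-- A decreasing list is determined by its multiset of values, because two sorted permutations of
each other coincide. -/
lemma apply_eq_of_antitone {n : ℕ} {f : Fin n → ℝ} (hf : Antitone f) {a b c : ℝ}
    (hab : b ≤ a) (hbc : c ≤ b) {k l m : ℕ}
    (h : Multiset.map f Finset.univ.val =
      Multiset.replicate k a + Multiset.replicate l b + Multiset.replicate m c) (i : Fin n) :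
    f i = if (i : ℕ) < k then a else if (i : ℕ) < k + l then b else c := by
  set L := List.replicate k a ++ List.replicate l b ++ List.replicate m c with hL
  have hperm : (List.ofFn f).Perm L := by
    rw [← Multiset.coe_eq_coe, ← Fin.univ_val_map, h, hL]
    simp only [← Multiset.coe_add, Multiset.coe_replicate]
  have hsort : L.Pairwise (· ≥ ·) := by
    simp only [hL, List.pairwise_append, List.pairwise_replicate, List.mem_append,
      List.mem_replicate]
    refine ⟨⟨Or.inr le_rfl, Or.inr le_rfl, ?_⟩, Or.inr le_rfl, ?_⟩
    · rintro x ⟨-, rfl⟩ y ⟨-, rfl⟩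
      exact hab
    · rintro x (⟨-, rfl⟩ | ⟨-, rfl⟩) y ⟨-, rfl⟩
      · exact hbc.trans hab
      · exact hbc
  have heq : List.ofFn f = L := hperm.eq_of_pairwise' hf.sortedGE_ofFn.pairwise hsort
  have hlen : (i : ℕ) < L.length := by rw [← heq]; simp
  have h1 : f i = L[(i : ℕ)] := by
    have : f i = (List.ofFn f)[(i : ℕ)]'(by simp) := by simp
    rw [this]
    simp only [heq]
  rw [h1]
  simp only [hL, List.getElem_append, List.getElem_replicate, List.length_append,
    List.length_replicate]
  split_ifs <;> first | rfl | omega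

end Multisets

/-! ### Spectrum of a symmetric operator that is quadratic up to a term of rank two. -/

section Spectral

variable {V : Type*} [NormedAddCommGroup V] [InnerProductSpace ℝ V] [FiniteDimensional ℝ V]
  {T : V →ₗ[ℝ] V} (hT : T.IsSymmetric) {n : ℕ} (hn : Module.finrank ℝ V = n)
  {B p q : ℝ} {L L' : V}

lemma quadratic_eigenvalues
    (hP : ∀ v, B • T (T v) - p • T v - q • v = (inner ℝ L v : ℝ) • L + (inner ℝ L' v : ℝ) • L')
    (i : Fin n) :
    B * hT.eigenvalues hn i ^ 2 - p * hT.eigenvalues hn i - q =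
      (inner ℝ L (hT.eigenvectorBasis hn i) : ℝ) ^ 2
        + (inner ℝ L' (hT.eigenvectorBasis hn i) : ℝ) ^ 2 := by
  have h := congrArg (fun w => (inner ℝ w (hT.eigenvectorBasis hn i) : ℝ))
    (hP (hT.eigenvectorBasis hn i))
  have h1 : (inner ℝ (hT.eigenvectorBasis hn i) (hT.eigenvectorBasis hn i) : ℝ) = 1 := by
    rw [real_inner_self_eq_norm_sq, (hT.eigenvectorBasis hn).norm_eq_one, one_pow]
  simp only [hT.apply_eigenvectorBasis, map_smul, RCLike.ofReal_real_eq_id, id, inner_sub_left,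
    inner_add_left, real_inner_smul_left, h1] at h
  linarith

lemma inner_eigenvectorBasis_eq_zero {ρ : ℝ} (hL : T L = ρ • L) {i : Fin n}
    (hi : hT.eigenvalues hn i ≠ ρ) : (inner ℝ L (hT.eigenvectorBasis hn i) : ℝ) = 0 := by
  have h := hT L (hT.eigenvectorBasis hn i)
  rw [hL, hT.apply_eigenvectorBasis, real_inner_smul_left] at h
  erw [real_inner_smul_right] at h
  have : (hT.eigenvalues hn i - ρ) * inner ℝ L (hT.eigenvectorBasis hn i) = 0 := by
    simp only [RCLike.ofReal_real_eq_id, id] at h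
    linarith
  exact (mul_eq_zero.1 this).resolve_left (sub_ne_zero.2 hi)

lemma sum_quadratic_eigenvalues
    (hP : ∀ v, B • T (T v) - p • T v - q • v = (inner ℝ L v : ℝ) • L + (inner ℝ L' v : ℝ) • L') :
    ∑ i, (B * hT.eigenvalues hn i ^ 2 - p * hT.eigenvalues hn i - q) = ‖L‖ ^ 2 + ‖L'‖ ^ 2 := by
  simp only [quadratic_eigenvalues hT hn hP, Finset.sum_add_distrib]
  simp only [OrthonormalBasis.sum_sq_inner_left]

lemma quadratic_eq_zero_of_ne {ρ : ℝ}
    (hP : ∀ v, B • T (T v) - p • T v - q • v = (inner ℝ L v : ℝ) • L + (inner ℝ L' v : ℝ) • L')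
    (hL : T L = ρ • L) (hL' : T L' = ρ • L') {i : Fin n} (hi : hT.eigenvalues hn i ≠ ρ) :
    B * hT.eigenvalues hn i ^ 2 - p * hT.eigenvalues hn i - q = 0 := by
  rw [quadratic_eigenvalues hT hn hP, inner_eigenvectorBasis_eq_zero hT hn hL hi,
    inner_eigenvectorBasis_eq_zero hT hn hL' hi]
  simp

/-- Take the trace of the quadratic identity: the right side contributes $2|L|^2$. On the left,
eigenvalues different from ρ contribute nothing and each one equal to ρ contributes $|L|^2$. -/
lemma card_eigenvalues_eq_two {ρ : ℝ}
    (hP : ∀ v, B • T (T v) - p • T v - q • v = (inner ℝ L v : ℝ) • L + (inner ℝ L' v : ℝ) • L')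
    (hL : T L = ρ • L) (hL' : T L' = ρ • L') (hnorm : ‖L'‖ = ‖L‖) (h0 : L ≠ 0)
    (hρ : B * ρ ^ 2 - p * ρ - q = ‖L‖ ^ 2) :
    Finset.card {i | hT.eigenvalues hn i = ρ} = 2 := by
  have h := sum_quadratic_eigenvalues hT hn hP
  rw [← Finset.sum_filter_add_sum_filter_not _ (fun i => hT.eigenvalues hn i = ρ),
    Finset.sum_eq_zero (s := Finset.univ.filter fun i => ¬ hT.eigenvalues hn i = ρ)
      (fun i hi => quadratic_eq_zero_of_ne hT hn hP hL hL' (Finset.mem_filter.1 hi).2),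
    Finset.sum_congr rfl (g := fun _ => ‖L‖ ^ 2) (fun i hi => by
      rw [(Finset.mem_filter.1 hi).2, hρ]), hnorm] at h
  rw [Finset.sum_const, nsmul_eq_mul, add_zero, ← two_mul] at h
  have h2 : ‖L‖ ^ 2 ≠ 0 := pow_ne_zero _ (norm_ne_zero_iff.2 h0)
  exact_mod_cast mul_right_cancel₀ h2 h

end Spectral

/-! ### From pointwise spectra to ordered eigenvalue functions. -/

section Functions

variable {M : Type*} [TopologicalSpace M] [ConnectedSpace M]

lemma eq_of_continuous_of_forall_exists_int {f : M → ℝ} (hf : Continuous f)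
    (h : ∀ x, ∃ j : ℤ, f x = j) (x y : M) : f x = f y := by
  choose g hg using h
  have hgc : Continuous g := by
    rw [Int.isClosedEmbedding_coe_real.isInducing.continuous_iff]
    exact hf.congr hg
  rw [hg, hg, PreconnectedSpace.constant inferInstance hgc (x := x) (y := y)]

/-- One real root forces the other to be real, namely `p / B - r` by Vieta. The point `s` excludes
the zero polynomial, so that `p ≠ 0` when `B = 0`; in that case the single root is listed as both
`a` and `c`. -/
lemma exists_quadratic_factors {B p q r s : ℝ} (hr : B * r ^ 2 - p * r - q = 0)
    (hs : B * s ^ 2 - p * s - q ≠ 0) :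
    ∃ a c : ℝ, c ≤ a ∧
      ((B ≠ 0 ∧ ∀ t, B * t ^ 2 - p * t - q = B * ((t - a) * (t - c))) ∨
        (B = 0 ∧ p ≠ 0 ∧ c = a ∧ ∀ t, B * t ^ 2 - p * t - q = -p * (t - a))) := by
  by_cases hB : B = 0
  · refine ⟨r, r, le_rfl, Or.inr ⟨hB, ?_, rfl, fun t => ?_⟩⟩
    · rintro rfl
      subst hB
      exact hs (by linarith)
    · subst hB
      linarith
  · have key : ∀ t, B * t ^ 2 - p * t - q = B * ((t - r) * (t - (p / B - r))) := fun t => by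
      field_simp
      linear_combination hr
    rcases le_total (p / B - r) r with h | h
    · exact ⟨_, _, h, Or.inl ⟨hB, key⟩⟩
    · exact ⟨_, _, h, Or.inl ⟨hB, fun t => by rw [key]; ring⟩⟩

/-- A system of ordered functions, two of which coincide with `ρ` at generic points while the others
are roots of a fixed polynomial of degree at most two, consists of at most two constants and `ρ`. -/
lemma exists_forall_eq_const_or_eq {n : ℕ} (hn : 3 ≤ n) {B p q : ℝ} {ev : M → Fin n → ℝ}
    {ρ N : M → ℝ} (hev : ∀ x, Antitone (ev x)) (hsum : Continuous fun x => ∑ i, ev x i)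
    (hρ : Continuous ρ) (hN : ∀ x, 0 ≤ N x) (hQ : ∀ x, B * ρ x ^ 2 - p * ρ x - q = N x)
    (hcard : ∀ x, N x ≠ 0 → Finset.card {i | ev x i = ρ x} = 2)
    (hroot : ∀ x i, ev x i ≠ ρ x → B * ev x i ^ 2 - p * ev x i - q = 0)
    (hdouble : 0 < B → ∀ r, (∀ t, B * t ^ 2 - p * t - q = B * ((t - r) * (t - r))) → ∀ x, ρ x ≠ r)
    (hne : ∃ x, N x ≠ 0) :
    ∃ a c : ℝ, (B = 0 → c = a) ∧ ∀ i, (∀ x, ev x i = a) ∨ (∀ x, ev x i = c) ∨ ∀ x, ev x i = ρ x := by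
  obtain ⟨x₀, hx₀⟩ := hne
  -- Since ρ occurs exactly twice at `x₀` and `3 ≤ n`, some other eigenvalue is present, and it
  -- provides a real root.
  obtain ⟨i₀, hi₀⟩ : ∃ i, ev x₀ i ≠ ρ x₀ := by
    by_contra! h
    have := hcard x₀ hx₀
    simp only [h, Finset.filter_true, Finset.card_univ, Fintype.card_fin] at this
    omega
  obtain ⟨a, c, hca, hfac⟩ := exists_quadratic_factors (hroot x₀ i₀ hi₀) (s := ρ x₀)
    (by rw [hQ]; exact hx₀)
  have hzero : ∀ t, B * t ^ 2 - p * t - q = 0 → t = a ∨ t = c := by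
    intro t ht
    rcases hfac with ⟨hB, h⟩ | ⟨-, hp, rfl, h⟩
    · rw [h] at ht
      rcases mul_eq_zero.1 ((mul_eq_zero.1 ht).resolve_left hB) with h | h
      · exact Or.inl (sub_eq_zero.1 h)
      · exact Or.inr (sub_eq_zero.1 h)
    · rw [h] at ht
      exact Or.inl (sub_eq_zero.1 ((mul_eq_zero.1 ht).resolve_left (neg_ne_zero.2 hp)))
  -- the spectrum at a generic point
  have hgen : ∀ x, N x ≠ 0 → ∃ j ≤ n - 2, Multiset.map (ev x) Finset.univ.val =
      Multiset.replicate j a + Multiset.replicate 2 (ρ x) + Multiset.replicate (n - 2 - j) c := by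
    intro x hx
    set s := Multiset.map (ev x) Finset.univ.val with hs
    have h1 : s.filter (fun t => t = ρ x) = Multiset.replicate 2 (ρ x) := by
      rw [Multiset.filter_eq', hs, Multiset.count_map, ← hcard x hx]
      congr 1
      simp [Finset.card_def, eq_comm]
    have h2 := Multiset.filter_add_not (fun t => t = ρ x) s
    have h3 : (s.filter fun t => ¬ t = ρ x).card = n - 2 := by
      have := congrArg Multiset.card h2
      rw [h1, Multiset.card_add, Multiset.card_replicate] at this
      simp [hs] at this ⊢
      omega
    obtain ⟨j, hj, h4⟩ := exists_eq_replicate_add (a := a) (c := c) (s.filter fun t => ¬ t = ρ x) (by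
      intro t ht
      obtain ⟨ht1, ht2⟩ := Multiset.mem_filter.1 ht
      obtain ⟨i, -, rfl⟩ := Multiset.mem_map.1 ht1
      exact hzero _ (hroot x i ht2))
    rw [h3] at hj h4
    refine ⟨j, hj, ?_⟩
    rw [← h2, h1, h4]
    abel
  -- Where `N` vanishes, ρ is itself a root, so the whole spectrum lies in `{a, c}`.
  have hspec : ∀ x, N x = 0 → (ρ x = a ∨ ρ x = c) ∧ ∃ j ≤ n, Multiset.map (ev x) Finset.univ.val =
      Multiset.replicate j a + Multiset.replicate (n - j) c := by
    intro x hx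
    refine ⟨hzero _ (by rw [hQ, hx]), ?_⟩
    obtain ⟨j, hj, h⟩ := exists_eq_replicate_add (a := a) (c := c)
      (Multiset.map (ev x) Finset.univ.val) (by
        intro t ht
        obtain ⟨i, -, rfl⟩ := Multiset.mem_map.1 ht
        by_cases hi : ev x i = ρ x
        · rw [hi]
          exact hzero _ (by rw [hQ, hx])
        · exact hzero _ (hroot x i hi))
    have hc : (Multiset.map (ev x) Finset.univ.val).card = n := by simp
    rw [hc] at hj h
    exact ⟨j, hj, h⟩
  have hmult : ∃ k, ∀ x, Multiset.map (ev x) Finset.univ.val =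
      Multiset.replicate k a + Multiset.replicate 2 (ρ x) + Multiset.replicate (n - 2 - k) c := by
    rcases hca.eq_or_lt with rfl | hlt
    · refine ⟨n - 2, fun x => ?_⟩
      by_cases hx : N x = 0
      · obtain ⟨h1, j, hj, h2⟩ := hspec x hx
        rw [or_self_iff.1 h1, h2, ← Multiset.replicate_add, ← Multiset.replicate_add,
          ← Multiset.replicate_add]
        congr 1
        omega
      · obtain ⟨j, hj, h2⟩ := hgen x hx
        rw [h2, add_right_comm, ← Multiset.replicate_add, add_right_comm, ← Multiset.replicate_add]
        congr 2
        omega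
    · have hsum' : ∀ x, (Multiset.map (ev x) Finset.univ.val).sum = ∑ i, ev x i := fun x => rfl
      have hac : a - c ≠ 0 := (sub_pos.2 hlt).ne'
      -- Solving the trace formula for the multiplicity of `a` that remains after two copies of ρ
      -- are removed gives κ. It is continuous and integer valued, hence constant. At a zero of `N`
      -- with `ρ x = a` its value is `j - 2`, not known in advance to be nonnegative, so integers
      -- are used rather than naturals.
      set κ : M → ℝ := fun x => (∑ i, ev x i - 2 * ρ x - (n - 2) * c) / (a - c) with hκ
      have hκc : Continuous κ := by fun_prop
      have hn2 : ((n - 2 : ℕ) : ℝ) = n - 2 := by rw [Nat.cast_sub (by omega)]; norm_num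
      have hκ1 : ∀ x j, j ≤ n - 2 → Multiset.map (ev x) Finset.univ.val =
          Multiset.replicate j a + Multiset.replicate 2 (ρ x) +
            Multiset.replicate (n - 2 - j) c → κ x = j := by
        intro x j hj h
        have h2 := congrArg Multiset.sum h
        rw [hsum'] at h2
        simp only [Multiset.sum_add, Multiset.sum_replicate, nsmul_eq_mul] at h2
        rw [Nat.cast_sub hj, hn2] at h2
        simp only [hκ]
        rw [h2, div_eq_iff hac]
        push_cast
        ring
      have hκ2 : ∀ x j, j ≤ n → Multiset.map (ev x) Finset.univ.val =
          Multiset.replicate j a + Multiset.replicate (n - j) c →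
          (ρ x = a → κ x = j - 2) ∧ (ρ x = c → κ x = j) := by
        intro x j hj h
        have h2 := congrArg Multiset.sum h
        rw [hsum'] at h2
        simp only [Multiset.sum_add, Multiset.sum_replicate, nsmul_eq_mul] at h2
        rw [Nat.cast_sub hj] at h2
        constructor
        all_goals
          intro h3
          simp only [hκ]
          rw [h2, h3, div_eq_iff hac]
          ring
      obtain ⟨k, hk, hk'⟩ := hgen x₀ hx₀
      have hconst : ∀ x, κ x = k := by
        intro x
        rw [← hκ1 x₀ k hk hk']
        refine eq_of_continuous_of_forall_exists_int hκc (fun y => ?_) _ _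
        by_cases hy : N y = 0
        · obtain ⟨h1, j, hj, h2⟩ := hspec y hy
          rcases h1 with h1 | h1
          · exact ⟨j - 2, by rw [(hκ2 y j hj h2).1 h1]; push_cast; ring⟩
          · exact ⟨j, by rw [(hκ2 y j hj h2).2 h1]; push_cast; ring⟩
        · obtain ⟨j, hj, h2⟩ := hgen y hy
          exact ⟨j, by rw [hκ1 y j hj h2]; push_cast; ring⟩
      refine ⟨k, fun x => ?_⟩
      by_cases hx : N x = 0
      · obtain ⟨h1, j, hj, h2⟩ := hspec x hx
        rcases h1 with h1 | h1
        · have h3 := (hκ2 x j hj h2).1 h1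
          rw [hconst, eq_sub_iff_add_eq] at h3
          have h4 : k + 2 = j := by exact_mod_cast h3
          rw [h2, h1, ← h4, ← Multiset.replicate_add]
          congr 2
          omega
        · have h3 := (hκ2 x j hj h2).2 h1
          rw [hconst] at h3
          have h4 : k = j := by exact_mod_cast h3
          rw [h2, h1, ← h4, add_assoc, ← Multiset.replicate_add]
          congr 2
          omega
      · obtain ⟨j, hj, h2⟩ := hgen x hx
        have h3 := hκ1 x j hj h2
        rw [hconst] at h3
        have h4 : k = j := by exact_mod_cast h3
        rw [h2, h4]
  obtain ⟨k, hk⟩ := hmult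
  -- The sign condition `0 ≤ P(ρ)` places ρ globally relative to the roots: between them if `B < 0`,
  -- on one fixed side if `B ≥ 0`. Thus the position of ρ in the decreasing order can be chosen
  -- independently of the point.
  have htri : (∀ x, a ≤ ρ x) ∨ (∀ x, ρ x ≤ c) ∨ ∀ x, c ≤ ρ x ∧ ρ x ≤ a := by
    rcases hfac with ⟨hB, h⟩ | ⟨-, hp, rfl, h⟩
    · have hpos : ∀ x, 0 ≤ B * ((ρ x - a) * (ρ x - c)) := fun x => by rw [← h, hQ]; exact hN x
      rcases lt_or_gt_of_ne hB with hB | hB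
      · refine Or.inr (Or.inr fun x => ?_)
        have h1 : (ρ x - a) * (ρ x - c) ≤ 0 := nonpos_of_mul_nonneg_right (hpos x) hB
        constructor
        · by_contra! h2
          nlinarith [mul_pos_of_neg_of_neg (sub_neg.2 (h2.trans_le hca)) (sub_neg.2 h2)]
        · by_contra! h2
          nlinarith [mul_pos (sub_pos.2 h2) (sub_pos.2 (hca.trans_lt h2))]
      · have h1 : ∀ x, 0 ≤ (ρ x - a) * (ρ x - c) := fun x => nonneg_of_mul_nonneg_right (hpos x) hB
        -- For `B > 0` the polynomial is negative at the midpoint of distinct roots, and `hdouble`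
        -- covers a double root. As ρ avoids the midpoint, the intermediate value theorem keeps it
        -- on one side.
        have h2 : ∀ x, ρ x ≠ (a + c) / 2 := by
          intro x hx
          have h3 := h1 x
          rw [hx] at h3
          have h4 : a = c := by nlinarith [sq_nonneg (a - c)]
          subst h4
          exact hdouble hB a h x (by rw [hx]; ring)
        by_cases h3 : ∃ x, (a + c) / 2 ≤ ρ x
        · refine Or.inl fun x => ?_
          have h4 : (a + c) / 2 < ρ x := by
            by_contra! h4
            obtain ⟨y, hy⟩ := mem_range_of_exists_le_of_exists_ge hρ ⟨x, h4⟩ h3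
            exact h2 y hy
          by_contra! h5
          nlinarith [h1 x, mul_pos (sub_pos.2 h5) (show 0 < ρ x - c by linarith)]
        · push Not at h3
          refine Or.inr (Or.inl fun x => ?_)
          by_contra! h5
          nlinarith [h1 x, mul_pos (sub_pos.2 h5) (show 0 < a - ρ x by linarith [h3 x])]
    · have hpos : ∀ x, 0 ≤ -p * (ρ x - c) := fun x => by rw [← h, hQ]; exact hN x
      rcases lt_or_gt_of_ne hp with hp | hp
      · exact Or.inl fun x => sub_nonneg.1 (nonneg_of_mul_nonneg_right (hpos x) (neg_pos.2 hp))
      · refine Or.inr (Or.inl fun x => ?_)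
        nlinarith [hpos x]
  refine ⟨a, c, fun hB => ?_, fun i => ?_⟩
  · rcases hfac with ⟨hB', h⟩ | ⟨-, -, h, -⟩
    · exact absurd hB hB'
    · exact h
  · rcases htri with h | h | h
    · have key : ∀ x, ev x i = if (i : ℕ) < 2 then ρ x else if (i : ℕ) < 2 + k then a else c :=
        fun x => apply_eq_of_antitone (hev x) (h x) hca (by rw [hk, add_comm (Multiset.replicate k a)]) i
      simp only [key]
      split_ifs <;> simp
    · have key : ∀ x, ev x i = if (i : ℕ) < k then a else
          if (i : ℕ) < k + (n - 2 - k) then c else ρ x :=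
        fun x => apply_eq_of_antitone (hev x) hca (h x) (by rw [hk, add_right_comm]) i
      simp only [key]
      split_ifs <;> simp
    · have key : ∀ x, ev x i = if (i : ℕ) < k then a else if (i : ℕ) < k + 2 then ρ x else c :=
        fun x => apply_eq_of_antitone (hev x) (h x).2 (h x).1 (hk x) i
      simp only [key]
      split_ifs <;> simp

end Functions
end KahlerMobility
namespace KahlerMobility

/-! ### The space of solutions, and the quadratic construction inside it. -/

variable {E : Type*} [NormedAddCommGroup E] [NormedSpace ℝ E]
  {M : Type*} [TopologicalSpace M] [ChartedSpace E M] [IsManifold 𝓘(ℝ, E) ∞ M]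
  [RiemannianBundle (fun x : M => TangentSpace 𝓘(ℝ, E) x)]
  [IsContMDiffRiemannianBundle 𝓘(ℝ, E) ∞ E (fun x : M => TangentSpace 𝓘(ℝ, E) x)]
  [FiniteDimensional ℝ E]

lemma leviCivita_metric_apply {Y Z : VField E M} {x : M} (hY : MDiffAt (T% Y) x)
    (hZ : MDiffAt (T% Z) x) (v : TangentSpace 𝓘(ℝ, E) x) :
    mvfderiv 𝓘(ℝ, E) (fun y => inner ℝ (Y y) (Z y)) x v =
      inner ℝ (leviCivita E M Y x v) (Z x) + inner ℝ (Y x) (leviCivita E M Z x v) := by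
  have h := leviCivita_metric (X := extend E v) (mdifferentiableAt_extend ..) hY hZ
  simpa using h

lemma contMDiffAt_inner {X Y : VField E M} {x : M}
    (hX : ContMDiffAt 𝓘(ℝ, E) (𝓘(ℝ, E).prod 𝓘(ℝ, E)) ∞
      (fun y => TotalSpace.mk' E (E := fun x : M => TangentSpace 𝓘(ℝ, E) x) y (X y)) x)
    (hY : ContMDiffAt 𝓘(ℝ, E) (𝓘(ℝ, E).prod 𝓘(ℝ, E)) ∞
      (fun y => TotalSpace.mk' E (E := fun x : M => TangentSpace 𝓘(ℝ, E) x) y (Y y)) x) :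
    ContMDiffAt 𝓘(ℝ, E) 𝓘(ℝ, ℝ) ∞ (fun y => (inner ℝ (X y) (Y y) : ℝ)) x :=
  ContMDiffAt.inner_bundle (IB := 𝓘(ℝ, E)) (F := E)
    (E := fun x : M => TangentSpace 𝓘(ℝ, E) x) hX hY

lemma SmoothV.mdiffAt {X : VField E M} (hX : SmoothV X) (x : M) : MDiffAt (T% X) x :=
  hX.mdifferentiable (by simp) x

namespace KahlerStructure

variable (K : KahlerStructure E M)

lemma inner_J_left (x : M) (v w : TangentSpace 𝓘(ℝ, E) x) :
    (inner ℝ (K.J x v) w : ℝ) = -inner ℝ v (K.J x w) := by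
  have h := K.inner_J x v (K.J x w)
  rw [K.J_sq, inner_neg_right] at h
  linarith

lemma inner_J_self (x : M) (v : TangentSpace 𝓘(ℝ, E) x) : (inner ℝ (K.J x v) v : ℝ) = 0 := by
  have h := K.inner_J_left x v v
  rw [real_inner_comm (K.J x v) v] at h
  linarith

lemma norm_J (x : M) (v : TangentSpace 𝓘(ℝ, E) x) : ‖K.J x v‖ = ‖v‖ := by
  rw [← sq_eq_sq₀ (norm_nonneg _) (norm_nonneg _), ← real_inner_self_eq_norm_sq,
    ← real_inner_self_eq_norm_sq, K.inner_J]

variable {K}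

lemma MainEq.add {A A' : EndField E M} {Λ Λ' : VField E M} (hA : SmoothEnd A) (hA' : SmoothEnd A')
    (h : K.MainEq A Λ) (h' : K.MainEq A' Λ') : K.MainEq (A + A') (Λ + Λ') := by
  intro Y x v hY
  rw [covDerivEnd_add hA hA' v hY, h Y x v hY, h' Y x v hY]
  simp only [Pi.add_apply, map_add, inner_add_left]
  module

lemma MainEq.smul {A : EndField E M} {Λ : VField E M} (hA : SmoothEnd A)
    (h : K.MainEq A Λ) (c : ℝ) : K.MainEq (c • A) (c • Λ) := by
  intro Y x v hY
  rw [covDerivEnd_smul c hA v hY, h Y x v hY]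
  simp only [Pi.smul_apply, map_smul, real_inner_smul_left]
  module

/-- Subtract the two equations and take both the direction and the argument to be
$w=\Lambda_x-\Lambda'_x$. As $\langle Jw,w\rangle=0$, only $2|w|^2w=0$ remains. -/
lemma MainEq.unique {A : EndField E M} {Λ Λ' : VField E M}
    (h : K.MainEq A Λ) (h' : K.MainEq A Λ') (x : M) : Λ x = Λ' x := by
  set w : TangentSpace 𝓘(ℝ, E) x := Λ x - Λ' x with hw
  have h1 := (h (extend E w) x w (mdifferentiableAt_extend ..)).symm.trans
    (h' (extend E w) x w (mdifferentiableAt_extend ..))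
  rw [extend_apply_self] at h1
  have h2 : (inner ℝ w w : ℝ) • w + (inner ℝ w w : ℝ) • w + (inner ℝ (K.J x w) w : ℝ) • K.J x w
      + (inner ℝ (K.J x w) w : ℝ) • K.J x w = 0 := by
    rw [← sub_eq_zero] at h1
    rw [← h1]
    have e1 : (inner ℝ w w : ℝ) = inner ℝ (Λ x) w - inner ℝ (Λ' x) w := by
      rw [← inner_sub_left]
    have e2 : (inner ℝ (K.J x w) w : ℝ) = inner ℝ (K.J x (Λ x)) w - inner ℝ (K.J x (Λ' x)) w := by
      rw [← inner_sub_left, ← map_sub]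
    have e3 : K.J x w = K.J x (Λ x) - K.J x (Λ' x) := by rw [hw, map_sub]
    have e4 : (inner ℝ w w : ℝ) • w = (inner ℝ w w : ℝ) • (Λ x - Λ' x) := rfl
    calc _ = (inner ℝ w w : ℝ) • (Λ x - Λ' x)
          + (inner ℝ (Λ x) w - inner ℝ (Λ' x) w : ℝ) • w
          + (inner ℝ (K.J x w) w : ℝ) • (K.J x (Λ x) - K.J x (Λ' x))
          + (inner ℝ (K.J x (Λ x)) w - inner ℝ (K.J x (Λ' x)) w : ℝ) • K.J x w := by
            rw [← e1, ← e2, ← e3, ← e4]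
      _ = _ := by module
  rw [K.inner_J_self, zero_smul, add_zero, add_zero, ← two_smul ℝ] at h2
  have h3 := ((smul_eq_zero.1 h2).resolve_left two_ne_zero)
  have h4 : w = 0 := by
    rcases smul_eq_zero.1 h3 with h | h
    · exact inner_self_eq_zero.1 h
    · exact h
  exact sub_eq_zero.1 h4

variable (E M) in
/-- The identity as a field of endomorphisms. -/
noncomputable def idField : EndField E M := fun _ => ContinuousLinearMap.id ℝ _

lemma smoothEnd_idField : SmoothEnd (idField E M) :=
  smoothEnd_of_apply fun _ _ hY => hY

lemma isHermitian_idField : K.IsHermitian (idField E M) :=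
  ⟨smoothEnd_idField, fun _ _ _ => rfl, fun _ _ => rfl⟩

lemma mainEq_idField : K.MainEq (idField E M) 0 := by
  intro Y x v hY
  simp [covDerivEnd, idField]

lemma smoothV_zero : SmoothV (0 : VField E M) :=
  contMDiff_zeroSection ℝ (fun x : M => TangentSpace 𝓘(ℝ, E) x)

/-- The identity, `A` and `C` are three elements of a space of dimension at most two. Their relation
passes to the vector fields because these are determined linearly by the endomorphism fields, by
`MainEq.unique`. -/
lemma exists_linear_relation (hK : ¬ 3 ≤ K.mobility) {A C : EndField E M} {Λ Ψ : VField E M}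
    (hA : K.IsHermitian A) (hΛ : SmoothV Λ) (hAΛ : K.MainEq A Λ)
    (hC : K.IsHermitian C) (hΨ : SmoothV Ψ) (hCΨ : K.MainEq C Ψ) :
    ∃ a b c : ℝ, (a ≠ 0 ∨ b ≠ 0 ∨ c ≠ 0) ∧
      (∀ (x : M) (v : TangentSpace 𝓘(ℝ, E) x), a • v + b • A x v + c • C x v = 0) ∧
      ∀ x, b • Λ x + c • Ψ x = 0 := by
  let s : Fin 3 → K.Sol := ![⟨idField E M, isHermitian_idField, 0, smoothV_zero, mainEq_idField⟩,
    ⟨A, hA, Λ, hΛ, hAΛ⟩, ⟨C, hC, Ψ, hΨ, hCΨ⟩]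
  have hs : ¬ LinearIndependent ℝ s := fun h => hK (by
    have := h.cardinal_lift_le_rank
    simpa [mobility] using this)
  obtain ⟨g, hg, i, hi⟩ := Fintype.not_linearIndependent_iff.1 hs
  have hrel : g 0 • idField E M + g 1 • A + g 2 • C = 0 := by
    have := congrArg (fun S : K.Sol => (S : EndField E M)) hg
    simpa [s, Fin.sum_univ_three] using this
  refine ⟨g 0, g 1, g 2, ?_, fun x v => ?_, fun x => ?_⟩
  · fin_cases i
    · exact Or.inl hi
    · exact Or.inr (Or.inl hi)
    · exact Or.inr (Or.inr hi)
  · exact congrArg (fun S : EndField E M => S x v) hrel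
  · have h1 : K.MainEq (g 0 • idField E M + g 1 • A + g 2 • C)
        (g 0 • (0 : VField E M) + g 1 • Λ + g 2 • Ψ) :=
      MainEq.add (ContMDiff.add_section (ContMDiff.const_smul_section smoothEnd_idField)
        (ContMDiff.const_smul_section hA.1)) (ContMDiff.const_smul_section hC.1)
        (MainEq.add (ContMDiff.const_smul_section smoothEnd_idField)
          (ContMDiff.const_smul_section hA.1) (mainEq_idField.smul smoothEnd_idField _)
          (hAΛ.smul hA.1 _)) (hCΨ.smul hC.1 _)
    have h2 : K.MainEq (g 0 • idField E M + g 1 • A + g 2 • C) 0 := by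
      have := (mainEq_idField (K := K)).smul smoothEnd_idField 0
      rw [hrel]
      simpa using this
    simpa using h1.unique h2 x

variable (K) in
/-- `(A, Λ, μ)` solves the closed system of linear equations defining `C_ℂ(B)`. -/
structure IsSolution (B : ℝ) (A : EndField E M) (Λ : VField E M) (μ : M → ℝ) : Prop where
  hermitian : K.IsHermitian A
  smooth : SmoothV Λ
  smooth_fun : ContMDiff 𝓘(ℝ, E) 𝓘(ℝ, ℝ) ∞ μ
  mainEq : K.MainEq A Λ
  deriv_vector : ∀ (x : M) (v : TangentSpace 𝓘(ℝ, E) x),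
    leviCivita E M Λ x v = μ x • v + B • A x v
  deriv_fun : ∀ (x : M) (v : TangentSpace 𝓘(ℝ, E) x),
    mvfderiv 𝓘(ℝ, E) μ x v = 2 * B * inner ℝ (Λ x) v

variable (K) in
/-- The quadratic expression `B A² - Λ♭ ⊗ Λ - (JΛ)♭ ⊗ JΛ`. -/
noncomputable def quadraticField (B : ℝ) (A : EndField E M) (Λ : VField E M) : EndField E M := fun x =>
  B • (A x).comp (A x) - (innerSL ℝ (Λ x)).smulRight (Λ x)
    - (innerSL ℝ (K.J x (Λ x))).smulRight (K.J x (Λ x))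

lemma quadraticField_apply (B : ℝ) (A : EndField E M) (Λ : VField E M) (x : M)
    (v : TangentSpace 𝓘(ℝ, E) x) :
    K.quadraticField B A Λ x v = B • A x (A x v) + (-(inner ℝ (Λ x) v : ℝ)) • Λ x
      + (-(inner ℝ (K.J x (Λ x)) v : ℝ)) • K.J x (Λ x) := by
  have : K.quadraticField B A Λ x v = B • A x (A x v) - (inner ℝ (Λ x) v : ℝ) • Λ x
      - (inner ℝ (K.J x (Λ x)) v : ℝ) • K.J x (Λ x) := rfl
  rw [this]
  module

lemma isHermitian_quadraticField {B : ℝ} {A : EndField E M} {Λ : VField E M}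
    (hA : K.IsHermitian A) (hΛ : SmoothV Λ) : K.IsHermitian (K.quadraticField B A Λ) := by
  refine ⟨smoothEnd_of_apply fun x Y hY => ?_, fun x v w => ?_, fun x v => ?_⟩
  · simp only [quadraticField_apply]
    have happ : ∀ {S : EndField E M} {Z : VField E M}, SmoothEnd S →
        ContMDiffAt 𝓘(ℝ, E) (𝓘(ℝ, E).prod 𝓘(ℝ, E)) ∞
          (fun y => TotalSpace.mk' E (E := fun x : M => TangentSpace 𝓘(ℝ, E) x) y (Z y)) x →
        ContMDiffAt 𝓘(ℝ, E) (𝓘(ℝ, E).prod 𝓘(ℝ, E)) ∞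
          (fun y => TotalSpace.mk' E (E := fun x : M => TangentSpace 𝓘(ℝ, E) x) y (S y (Z y))) x :=
      fun hS hZ => ContMDiffAt.clm_bundle_apply (F₁ := E) (F₂ := E)
        (E₁ := fun x : M => TangentSpace 𝓘(ℝ, E) x) (E₂ := fun x : M => TangentSpace 𝓘(ℝ, E) x)
        (hS x) hZ
    have hsm : ∀ {Z : VField E M},
        ContMDiffAt 𝓘(ℝ, E) (𝓘(ℝ, E).prod 𝓘(ℝ, E)) ∞
          (fun y => TotalSpace.mk' E (E := fun x : M => TangentSpace 𝓘(ℝ, E) x) y (Z y)) x →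
        ContMDiffAt 𝓘(ℝ, E) (𝓘(ℝ, E).prod 𝓘(ℝ, E)) ∞
          (fun y => TotalSpace.mk' E (E := fun x : M => TangentSpace 𝓘(ℝ, E) x) y
            ((-(inner ℝ (Z y) (Y y) : ℝ)) • Z y)) x := fun hZ =>
      ContMDiffAt.smul_section (contMDiffAt_inner hZ hY).neg hZ
    exact ((ContMDiffAt.const_smul_section (happ hA.1 (happ hA.1 hY))).add_section
      (hsm (hΛ x))).add_section (hsm (happ K.smooth_J (hΛ x)))
  · simp only [quadraticField_apply, inner_add_left, inner_add_right, real_inner_smul_left,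
      real_inner_smul_right, hA.2.1]
    rw [real_inner_comm v (Λ x), real_inner_comm v (K.J x (Λ x))]
    ring
  · simp only [quadraticField_apply, map_add, map_smul, hA.2.2, K.J_sq, K.inner_J, K.inner_J_left,
      neg_neg]
    module

/-- In the derivative of $BA^2$, the terms pairing Λ with $Av$ cancel against the `B A` part of ∇Λ,
and likewise for JΛ. What is left, together with the μ part, has the shape of the main equation for
$BA\Lambda-\mu\Lambda$. -/
lemma IsSolution.mainEq_quadraticField {B : ℝ} {A : EndField E M} {Λ : VField E M} {μ : M → ℝ}
    (h : K.IsSolution B A Λ μ) :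
    K.MainEq (K.quadraticField B A Λ) (fun x => B • A x (Λ x) - μ x • Λ x) := by
  intro Y x v hY
  have hAY := mdiff_end_apply h.hermitian.1 hY
  have hAAY := mdiff_end_apply h.hermitian.1 hAY
  have hΛ := h.smooth.mdiffAt x
  have hJΛ := mdiff_end_apply K.smooth_J hΛ
  have hLC := (leviCivita E M).isCovariantDerivativeOn (s := Set.univ)
  have hf := (mdiff_inner hΛ hY).neg
  have hg := (mdiff_inner hJΛ hY).neg
  have hsplit : (fun y => K.quadraticField B A Λ y (Y y)) =
      B • (fun y => A y (A y (Y y)) : VField E M)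
      + (-fun y => (inner ℝ (Λ y) (Y y) : ℝ)) • Λ
      + (-fun y => (inner ℝ (K.J y (Λ y)) (Y y) : ℝ)) • (fun y => K.J y (Λ y) : VField E M) := by
    funext y
    exact quadraticField_apply B A Λ y (Y y)
  have d1 : leviCivita E M (fun y => A y (Y y)) x v = covDerivEnd A Y x v
      + A x (leviCivita E M Y x v) := by rw [covDerivEnd]; abel
  have d2 : leviCivita E M (fun y => A y (A y (Y y))) x v =
      covDerivEnd A (fun y => A y (Y y)) x v + A x (leviCivita E M (fun y => A y (Y y)) x v) := by
    rw [covDerivEnd]; abel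
  have d3 : leviCivita E M (fun y => K.J y (Λ y)) x v = K.J x (leviCivita E M Λ x v) :=
    sub_eq_zero.1 (K.J_parallel Λ x v hΛ)
  have e1 : mvfderiv 𝓘(ℝ, E) (-fun y => (inner ℝ (Λ y) (Y y) : ℝ)) x v =
      -(inner ℝ (leviCivita E M Λ x v) (Y x) + inner ℝ (Λ x) (leviCivita E M Y x v)) := by
    rw [mvfderiv_neg, ← leviCivita_metric_apply hΛ hY]; rfl
  have e2 : mvfderiv 𝓘(ℝ, E) (-fun y => (inner ℝ (K.J y (Λ y)) (Y y) : ℝ)) x v =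
      -(inner ℝ (K.J x (leviCivita E M Λ x v)) (Y x)
        + inner ℝ (K.J x (Λ x)) (leviCivita E M Y x v)) := by
    rw [mvfderiv_neg, ← d3, ← leviCivita_metric_apply hJΛ hY]; rfl
  have hBA : MDiffAt (T% (B • (fun y => A y (A y (Y y)) : VField E M))) x :=
    MDifferentiableAt.smul_section
      (mdifferentiableAt_const (I := 𝓘(ℝ, E)) (I' := 𝓘(ℝ, ℝ)) (c := B)) hAAY
  rw [covDerivEnd, hsplit, hLC.add (mdifferentiableAt_add_section hBA (hf.smul_section hΛ))
    (hg.smul_section hJΛ), hLC.add hBA (hf.smul_section hΛ), hLC.smul_const B hAAY,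
    hLC.leibniz hΛ hf, hLC.leibniz hJΛ hg]
  simp only [_root_.add_apply, _root_.smul_apply, ContinuousLinearMap.smulRight_apply, e1, e2]
  rw [d2, d1, d3, h.mainEq Y x v hY, h.mainEq _ x v hAY, quadraticField_apply, h.deriv_vector]
  have hsym := h.hermitian.2.1 x
  have hcomm := h.hermitian.2.2 x
  simp only [map_add, map_sub, map_smul, ← hsym, hcomm, inner_add_left, inner_sub_left,
    real_inner_smul_left, Pi.neg_apply]
  module

end KahlerStructure
end KahlerMobility
namespace KahlerMobility

/-! ### Spectrum of a solution of the closed system when the mobility is at most two. -/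

variable {E : Type*} [NormedAddCommGroup E] [NormedSpace ℝ E]
  {M : Type*} [TopologicalSpace M] [ChartedSpace E M] [IsManifold 𝓘(ℝ, E) ∞ M]
  [RiemannianBundle (fun x : M => TangentSpace 𝓘(ℝ, E) x)]
  [IsContMDiffRiemannianBundle 𝓘(ℝ, E) ∞ E (fun x : M => TangentSpace 𝓘(ℝ, E) x)]
  [FiniteDimensional ℝ E]

lemma SmoothV.mdiff_norm_sq {X : VField E M} (hX : SmoothV X) :
    MDiff (fun x => (inner ℝ (X x) (X x) : ℝ)) :=
  fun x => mdiff_inner (hX.mdiffAt x) (hX.mdiffAt x)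

namespace KahlerStructure

variable {K : KahlerStructure E M} {B : ℝ} {A : EndField E M} {Λ : VField E M} {μ : M → ℝ}

lemma IsSolution.smooth_vector (h : K.IsSolution B A Λ μ) :
    SmoothV (fun x => B • A x (Λ x) - μ x • Λ x) :=
  have hAΛ : SmoothV (fun x => A x (Λ x)) := ContMDiff.clm_bundle_apply (F₁ := E) (F₂ := E)
    (E₁ := fun x : M => TangentSpace 𝓘(ℝ, E) x) (E₂ := fun x : M => TangentSpace 𝓘(ℝ, E) x)
    h.hermitian.1 h.smooth
  ContMDiff.sub_section (ContMDiff.const_smul_section hAΛ)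
    (ContMDiff.smul_section h.smooth_fun h.smooth)

/-- The closed system is stable under affine changes $C=a\,\mathrm{Id}+bA$: substituting
$bA=C-a\,\mathrm{Id}$ in $b\nabla\Lambda$ produces the new function $b\mu-aB$. -/
lemma IsSolution.smul_add_id (h : K.IsSolution B A Λ μ) {C : EndField E M} (hC : K.IsHermitian C)
    {Ψ : VField E M} (hCΨ : K.MainEq C Ψ) (hΨ : SmoothV Ψ) {a b : ℝ}
    (hCA : ∀ (x : M) (v : TangentSpace 𝓘(ℝ, E) x), C x v = a • v + b • A x v)
    (hΨΛ : ∀ x, Ψ x = b • Λ x) : K.IsSolution B C Ψ (fun x => b * μ x - a * B) := by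
  obtain rfl : Ψ = b • Λ := funext hΨΛ
  refine ⟨hC, hΨ, (contMDiff_const.mul h.smooth_fun).sub contMDiff_const, hCΨ, fun x v => ?_,
    fun x v => ?_⟩
  · rw [(leviCivita E M).isCovariantDerivativeOn (s := Set.univ) |>.smul_const b
      (h.smooth.mdiffAt x), _root_.smul_apply, h.deriv_vector, hCA]
    module
  · have hμ := h.smooth_fun.mdifferentiable (by simp) x
    have h1 : mvfderiv 𝓘(ℝ, E) (fun x => b * μ x - a * B) x = b • mvfderiv 𝓘(ℝ, E) μ x := by
      refine (mvfderiv_sub (mdifferentiableAt_const.mul hμ) mdifferentiableAt_const).trans ?_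
      rw [mvfderiv_const, sub_zero]
      refine (mvfderiv_mul mdifferentiableAt_const hμ).trans ?_
      rw [mvfderiv_const, smul_zero, add_zero]
    rw [h1, _root_.smul_apply, h.deriv_fun, Pi.smul_apply, real_inner_smul_left, smul_eq_mul]
    ring

/-- If the mobility is at most two, then the vector field of a solution consists of eigenvectors
and the field of endomorphisms satisfies a quadratic equation up to a term of rank two. -/
lemma IsSolution.exists_quadratic (h : K.IsSolution B A Λ μ) (hK : ¬ 3 ≤ K.mobility)
    {x₀ : M} (hx₀ : Λ x₀ ≠ 0) :
    ∃ p q : ℝ, (∀ (x : M) (v : TangentSpace 𝓘(ℝ, E) x), B • A x (A x v) - p • A x v - q • v =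
        (inner ℝ (Λ x) v : ℝ) • Λ x + (inner ℝ (K.J x (Λ x)) v : ℝ) • K.J x (Λ x)) ∧
      ∀ x, B • A x (Λ x) = (p + μ x) • Λ x := by
  obtain ⟨a, b, c, hne, h1, h2⟩ := exists_linear_relation hK h.hermitian h.smooth h.mainEq
    (isHermitian_quadraticField (B := B) h.hermitian h.smooth) h.smooth_vector
    h.mainEq_quadraticField
  -- A relation between the identity and `A` alone is trivial: evaluating the vector fields at `x₀`
  -- gives `b = 0`, and then `a = 0`.
  have hc : c ≠ 0 := by
    rintro rfl
    have hb : b = 0 := by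
      have := h2 x₀
      rw [zero_smul, add_zero] at this
      exact (smul_eq_zero.1 this).resolve_right hx₀
    have ha : a = 0 := by
      have := h1 x₀ (Λ x₀)
      rw [hb, zero_smul, zero_smul, add_zero, add_zero] at this
      exact (smul_eq_zero.1 this).resolve_right hx₀
    simp [ha, hb] at hne
  refine ⟨-(b / c), -(a / c), fun x v => ?_, fun x => ?_⟩
  · have h3 := congrArg (fun w => c⁻¹ • w) (h1 x v)
    simp only [quadraticField_apply, smul_zero, smul_add, smul_smul, inv_mul_cancel_left₀ hc] at h3
    rw [← sub_eq_zero, ← h3]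
    module
  · have h3 := congrArg (fun w => c⁻¹ • w) (h2 x)
    simp only [smul_zero, smul_add, smul_smul, smul_sub] at h3
    rw [← mul_assoc, ← mul_assoc, inv_mul_cancel₀ hc] at h3
    rw [← sub_eq_zero, ← h3]
    module

lemma eigenvector_quadratic {p q ρ : ℝ} {x : M}
    (hP : ∀ v : TangentSpace 𝓘(ℝ, E) x, B • A x (A x v) - p • A x v - q • v =
        (inner ℝ (Λ x) v : ℝ) • Λ x + (inner ℝ (K.J x (Λ x)) v : ℝ) • K.J x (Λ x))
    (hρ : A x (Λ x) = ρ • Λ x) (hx : Λ x ≠ 0) :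
    B * ρ ^ 2 - p * ρ - q = inner ℝ (Λ x) (Λ x) := by
  have h := hP (Λ x)
  rw [K.inner_J_self, hρ, map_smul, hρ, zero_smul, add_zero] at h
  have h2 : (B * ρ ^ 2 - p * ρ - q - inner ℝ (Λ x) (Λ x)) • Λ x = 0 := by
    rw [sub_smul, ← h]
    module
  exact sub_eq_zero.1 ((smul_eq_zero.1 h2).resolve_right hx)

lemma IsSolution.mvfderiv_div_eq (h : K.IsSolution B A Λ μ) (hB : B ≠ 0) (p : ℝ) (x : M)
    (v : TangentSpace 𝓘(ℝ, E) x) :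
    mvfderiv 𝓘(ℝ, E) (fun x => B⁻¹ * (p + μ x)) x v = 2 * inner ℝ (Λ x) v := by
  have hμ := h.smooth_fun.mdifferentiable (by simp) x
  have h1 : mvfderiv 𝓘(ℝ, E) (fun x => B⁻¹ * (p + μ x)) x = B⁻¹ • mvfderiv 𝓘(ℝ, E) μ x := by
    refine (mvfderiv_mul mdifferentiableAt_const (mdifferentiableAt_const.add hμ)).trans ?_
    rw [mvfderiv_const, smul_zero, add_zero]
    congr 1
    refine (mvfderiv_add mdifferentiableAt_const hμ).trans ?_
    rw [mvfderiv_const, zero_add]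
  rw [h1, _root_.smul_apply, h.deriv_fun, smul_eq_mul]
  field_simp

/-- The double eigenvalue of a solution on the complex line spanned by its vector field. -/
lemma IsSolution.exists_eigenvalue [ConnectedSpace M] (h : K.IsSolution B A Λ μ)
    (hE : 3 ≤ Module.finrank ℝ E) {x₀ : M} (hx₀ : Λ x₀ ≠ 0) {p q : ℝ}
    (hP : ∀ (x : M) (v : TangentSpace 𝓘(ℝ, E) x), B • A x (A x v) - p • A x v - q • v =
        (inner ℝ (Λ x) v : ℝ) • Λ x + (inner ℝ (K.J x (Λ x)) v : ℝ) • K.J x (Λ x))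
    (hΛ : ∀ x, B • A x (Λ x) = (p + μ x) • Λ x) :
    ∃ ρ : M → ℝ, Continuous ρ ∧ (∀ x, A x (Λ x) = ρ x • Λ x) ∧
      (∀ x, B * ρ x ^ 2 - p * ρ x - q = ‖Λ x‖ ^ 2) ∧
      (0 < B → ∀ r, (∀ t, B * t ^ 2 - p * t - q = B * ((t - r) * (t - r))) → ∀ x, ρ x ≠ r) ∧
      (B ≠ 0 → ¬ ∃ c, ∀ x, ρ x = c) := by
  simp only [← real_inner_self_eq_norm_sq]
  by_cases hB : B = 0
  · subst hB
    -- If `p = 0` as well, then $-q\,\mathrm{Id}$ equals a term of rank two. Comparing traces gives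
    -- $-q\dim E=-2q$ with $-q=|\Lambda_{x_0}|^2>0$, impossible in dimension at least three.
    have hp : p ≠ 0 := by
      rintro rfl
      have h1 : -q = inner ℝ (Λ x₀) (Λ x₀) := by
        have h2 := congrArg (fun w => (inner ℝ w (Λ x₀) : ℝ)) (hP x₀ (Λ x₀))
        simp only [zero_smul, sub_zero, zero_sub, K.inner_J_self, add_zero, inner_neg_left,
          real_inner_smul_left] at h2
        have h3 : (inner ℝ (Λ x₀) (Λ x₀) : ℝ) ≠ 0 := inner_self_ne_zero.2 hx₀
        exact mul_right_cancel₀ h3 (by linarith)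
      have h2 := sum_quadratic_eigenvalues (n := Module.finrank ℝ E)
        (T := (A x₀).toLinearMap) (h.hermitian.2.1 x₀) rfl (hP x₀)
      rw [K.norm_J, ← real_inner_self_eq_norm_sq, ← h1] at h2
      simp only [zero_mul, sub_zero, zero_sub, Finset.sum_const, Finset.card_univ,
        Fintype.card_fin, nsmul_eq_mul] at h2
      have h3 : (0 : ℝ) < -q := h1 ▸ real_inner_self_pos.2 hx₀
      have h4 : (3 : ℝ) ≤ Module.finrank ℝ E := by exact_mod_cast hE
      nlinarith
    -- For `B = 0` the relation for $BA\Lambda$ says nothing about $A\Lambda$; ρ is obtained by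
    -- solving $P(\rho)=|\Lambda|^2$, which is linear in ρ.
    refine ⟨fun x => -(q + inner ℝ (Λ x) (Λ x)) / p, ?_, fun x => ?_, fun x => ?_, ?_, ?_⟩
    · have := h.smooth.mdiff_norm_sq.continuous
      fun_prop
    · have h1 := hP x (Λ x)
      rw [K.inner_J_self, zero_smul, zero_smul, add_zero, zero_sub] at h1
      have h2 : p • A x (Λ x) = (-(q + inner ℝ (Λ x) (Λ x))) • Λ x := by
        rw [neg_smul, add_smul, ← h1]
        module
      beta_reduce
      rw [div_eq_inv_mul, mul_smul, ← h2, smul_smul, inv_mul_cancel₀ hp, one_smul]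
    · field_simp
      ring
    · exact fun h => absurd h (lt_irrefl _)
    · exact fun h => absurd rfl h
  · set ρ : M → ℝ := fun x => B⁻¹ * (p + μ x) with hρ
    have hρd : MDiff ρ := fun x =>
      mdifferentiableAt_const.mul (mdifferentiableAt_const.add
        (h.smooth_fun.mdifferentiable (by simp) x))
    have hdρ : ∀ (x : M) (v : TangentSpace 𝓘(ℝ, E) x),
      mvfderiv 𝓘(ℝ, E) ρ x v = 2 * inner ℝ (Λ x) v := h.mvfderiv_div_eq hB p
    have hBρ : ∀ x, B * ρ x = p + μ x := fun x => mul_inv_cancel_left₀ hB _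
    have hev : ∀ x, A x (Λ x) = ρ x • Λ x := fun x => by
      rw [hρ, mul_smul, ← hΛ x, smul_smul, inv_mul_cancel₀ hB, one_smul]
    -- At zeros of Λ the eigenvector argument gives no information. Instead, $P(\rho)-|\Lambda|^2$
    -- has zero differential by the closed system, so it is constant, and it vanishes at `x₀`.
    have hQ : ∀ x, B * ρ x ^ 2 - p * ρ x - q = inner ℝ (Λ x) (Λ x) := by
      intro x
      have hF : ∀ x, mvfderiv 𝓘(ℝ, E)
          (fun y => B * (ρ y * ρ y) - p * ρ y - inner ℝ (Λ y) (Λ y)) x = 0 := by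
        intro x
        have hc : ∀ c : ℝ, MDifferentiableAt 𝓘(ℝ, E) 𝓘(ℝ, ℝ) (fun _ : M => c) x :=
          fun c => mdifferentiableAt_const
        have e1 : mvfderiv 𝓘(ℝ, E) (fun y => ρ y * ρ y) x = (2 * ρ x) • mvfderiv 𝓘(ℝ, E) ρ x :=
          (mvfderiv_mul (hρd x) (hρd x)).trans (by module)
        have e2 : mvfderiv 𝓘(ℝ, E) (fun y => B * (ρ y * ρ y)) x
            = B • (2 * ρ x) • mvfderiv 𝓘(ℝ, E) ρ x := by
          refine (mvfderiv_mul (hc B) ((hρd x).mul (hρd x))).trans ?_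
          rw [mvfderiv_const, smul_zero, add_zero]
          exact congrArg _ e1
        have e3 : mvfderiv 𝓘(ℝ, E) (fun y => p * ρ y) x = p • mvfderiv 𝓘(ℝ, E) ρ x := by
          refine (mvfderiv_mul (hc p) (hρd x)).trans ?_
          rw [mvfderiv_const, smul_zero, add_zero]
        have e4 : mvfderiv 𝓘(ℝ, E)
            (fun y => B * (ρ y * ρ y) - p * ρ y - inner ℝ (Λ y) (Λ y)) x =
            B • (2 * ρ x) • mvfderiv 𝓘(ℝ, E) ρ x - p • mvfderiv 𝓘(ℝ, E) ρ x
              - mvfderiv 𝓘(ℝ, E) (fun y => (inner ℝ (Λ y) (Λ y) : ℝ)) x := by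
          rw [← e2, ← e3]
          refine (mvfderiv_sub (((hc B).mul ((hρd x).mul (hρd x))).sub ((hc p).mul (hρd x)))
            (h.smooth.mdiff_norm_sq x)).trans ?_
          congr 1
          exact mvfderiv_sub ((hc B).mul ((hρd x).mul (hρd x))) ((hc p).mul (hρd x))
        ext v
        rw [e4]
        simp only [_root_.sub_apply, _root_.smul_apply, smul_eq_mul, hdρ,
          leviCivita_metric_apply (h.smooth.mdiffAt x) (h.smooth.mdiffAt x), h.deriv_vector,
          inner_add_left, inner_add_right, real_inner_smul_left, real_inner_smul_right,
          h.hermitian.2.1 x, ← h.hermitian.2.1 x (Λ x), hev,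
          _root_.zero_apply]
        rw [show (inner ℝ (Λ x) v : ℝ) = inner ℝ v (Λ x) from real_inner_comm _ _]
        have := hBρ x
        linear_combination (2 * inner ℝ v (Λ x)) * this
      have hFd : MDiff (fun y => B * (ρ y * ρ y) - p * ρ y - inner ℝ (Λ y) (Λ y)) := fun y =>
        ((mdifferentiableAt_const.mul ((hρd y).mul (hρd y))).sub
          (mdifferentiableAt_const.mul (hρd y))).sub (h.smooth.mdiff_norm_sq y)
      have h1 := eq_of_mvfderiv_eq_zero hFd hF x x₀
      have h2 := eigenvector_quadratic (hP x₀) (hev x₀) hx₀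
      linarith
    refine ⟨ρ, hρd.continuous, hev, hQ, fun hB r hr x hx => ?_, fun _ => ?_⟩
    -- With a double root `r`, $|\Lambda|=\sqrt B\,|\rho-r|$, so $d\rho=2\Lambda^\flat$ is bounded
    -- by a multiple of $|\rho-r|$. If ρ took the value `r` once, it would do so everywhere, and Λ
    -- would vanish at `x₀`.
    · have hle : ∀ (x : M) (v : TangentSpace 𝓘(ℝ, E) x),
          |mvfderiv 𝓘(ℝ, E) (fun y => ρ y - r) x v| ≤ (2 * √B) * |ρ x - r| * ‖v‖ := by
        intro x v
        have e1 : mvfderiv 𝓘(ℝ, E) (fun y => ρ y - r) x = mvfderiv 𝓘(ℝ, E) ρ x := by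
          refine (mvfderiv_sub (hρd x) mdifferentiableAt_const).trans ?_
          rw [mvfderiv_const, sub_zero]
        have e2 : ‖Λ x‖ = √B * |ρ x - r| := by
          rw [← Real.sqrt_sq_eq_abs, ← Real.sqrt_mul hB.le, sq, ← hr, hQ,
            real_inner_self_eq_norm_sq, Real.sqrt_sq (norm_nonneg _)]
        rw [e1, hdρ, abs_mul, abs_two, mul_assoc, mul_assoc, ← mul_assoc √B, ← e2]
        gcongr
        exact abs_real_inner_le_norm _ _
      have h0 := eq_zero_of_abs_mvfderiv_le (u := fun y => ρ y - r)
        (fun y => (hρd y).sub mdifferentiableAt_const) (by positivity) hle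
        (x := x) (sub_eq_zero.2 hx) x₀
      have h1 := hQ x₀
      rw [hr, h0, mul_zero, mul_zero] at h1
      exact hx₀ (inner_self_eq_zero.1 h1.symm)
    · rintro ⟨c, hc⟩
      have h1 := hdρ x₀ (Λ x₀)
      rw [show ρ = fun _ => c from funext hc, mvfderiv_const] at h1
      have h2 : (inner ℝ (Λ x₀) (Λ x₀) : ℝ) = 0 := by
        rw [_root_.zero_apply] at h1
        linarith
      exact hx₀ (inner_self_eq_zero.1 h2)

lemma continuous_sum_eigenvalueFun (A : K.Sol) :
    Continuous fun x => ∑ i, eigenvalueFun A i x := by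
  refine (continuous_trace A.2.1.1).congr fun x => ?_
  exact (LinearMap.IsSymmetric.trace_eq_sum_eigenvalues (hT := A.2.1.2.1 x) (hn := rfl))

/-- If the mobility is at most two, then the eigenvalues of a solution with nonvanishing vector
field are two constants and one function, and either this function is nonconstant or the two
constants agree. -/
lemma IsSolution.exists_eigenvalueFun_eq [ConnectedSpace M] (A : K.Sol)
    (h : K.IsSolution B A Λ μ) (hK : ¬ 3 ≤ K.mobility)
    (hE : 3 ≤ Module.finrank ℝ E) {x₀ : M} (hx₀ : Λ x₀ ≠ 0) :
    ∃ (a c : ℝ) (ρ : M → ℝ), (c = a ∨ ¬ ∃ t, ∀ x, ρ x = t) ∧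
      ∀ i, eigenvalueFun A i = (fun _ => a) ∨ eigenvalueFun A i = (fun _ => c) ∨
        eigenvalueFun A i = ρ := by
  obtain ⟨p, q, hP, hΛ⟩ := h.exists_quadratic hK hx₀
  obtain ⟨ρ, hρc, hev, hQ, hdouble, hconst⟩ := h.exists_eigenvalue hE hx₀ hP hΛ
  have hevJ : ∀ x, (A : EndField E M) x (K.J x (Λ x)) = ρ x • K.J x (Λ x) := fun x => by
    rw [h.hermitian.2.2, hev, map_smul]
  obtain ⟨a, c, hac, hi⟩ := exists_forall_eq_const_or_eq hE (B := B) (p := p) (q := q)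
    (ev := fun x i => eigenvalueFun A i x) (ρ := ρ) (N := fun x => ‖Λ x‖ ^ 2)
    (fun x => LinearMap.IsSymmetric.eigenvalues_antitone (A.2.1.2.1 x) rfl)
    (continuous_sum_eigenvalueFun A) hρc (fun x => sq_nonneg _) hQ
    (fun x hx => card_eigenvalues_eq_two (A.2.1.2.1 x) rfl (hP x) (hev x) (hevJ x)
      (K.norm_J x _) (fun h0 => hx (by simp [h0])) (hQ x))
    (fun x i hne => quadratic_eq_zero_of_ne (A.2.1.2.1 x) rfl (hP x) (hev x) (hevJ x) hne)
    hdouble ⟨x₀, pow_ne_zero _ (norm_ne_zero_iff.2 hx₀)⟩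
  refine ⟨a, c, ρ, ?_, fun i => ?_⟩
  · by_cases hB : B = 0
    · exact Or.inl (hac hB)
    · exact Or.inr (hconst hB)
  · rcases hi i with h | h | h
    · exact Or.inl (funext h)
    · exact Or.inr (Or.inl (funext h))
    · exact Or.inr (Or.inr (funext h))

/-- Only ρ can be nonconstant. The constant ones lie in `{a, c}` if ρ is not constant, and in `{a,
ρ}` if `c = a`. -/
lemma num_eigenvalues_lt {A : K.Sol} {a c : ℝ} {ρ : M → ℝ} (hρ : c = a ∨ ¬ ∃ t, ∀ x, ρ x = t)
    (h : ∀ i, eigenvalueFun A i = (fun _ => a) ∨ eigenvalueFun A i = (fun _ => c) ∨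
        eigenvalueFun A i = ρ) :
    numNonconstEigenvalues A < 2 ∧ numConstEigenvalues A < 3 := by
  constructor
  · refine (Set.ncard_le_ncard (t := {ρ}) ?_ (Set.finite_singleton _)).trans_lt (by simp)
    rintro _ ⟨⟨i, rfl⟩, hn⟩
    rcases h i with h | h | h
    · exact absurd ⟨a, fun x => congrFun h x⟩ hn
    · exact absurd ⟨c, fun x => congrFun h x⟩ hn
    · exact h
  · rcases hρ with rfl | hρ
    · refine (Set.ncard_le_ncard (t := {fun _ => c, ρ}) ?_ (Set.toFinite _)).trans_lt
        ((Set.ncard_insert_le _ _).trans_lt (by simp))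
      rintro _ ⟨⟨i, rfl⟩, -⟩
      rcases h i with h | h | h
      · exact Or.inl h
      · exact Or.inl h
      · exact Or.inr h
    · refine (Set.ncard_le_ncard (t := {fun _ => a, fun _ => c}) ?_ (Set.toFinite _)).trans_lt
        ((Set.ncard_insert_le _ _).trans_lt (by simp))
      rintro _ ⟨⟨i, rfl⟩, hn⟩
      rcases h i with h | h | h
      · exact Or.inl h
      · exact Or.inr h
      · exact absurd (h ▸ hn) hρ

lemma eigenvalueFun_eq_const {A : K.Sol} {a : ℝ}
    (h : ∀ (x : M) (v : TangentSpace 𝓘(ℝ, E) x), (A : EndField E M) x v = a • v)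
    (i : Fin (Module.finrank ℝ E)) : eigenvalueFun A i = fun _ => a := by
  funext x
  have h1 := (LinearMap.IsSymmetric.hasEigenvalue_eigenvalues (A.2.1.2.1 x) rfl i).exists_hasEigenvector
  obtain ⟨v, hv⟩ := h1
  have h2 := hv.apply_eq_smul
  have h3 := (h x v).symm.trans h2
  exact (smul_left_injective ℝ hv.2 h3).symm

end KahlerStructure
end KahlerMobility

/-! ### Reduction of an arbitrary element of `Sol` to a solution of the closed system. -/

theorem theorem3p3 {m : ℕ} (hm : 2 ≤ m)
    {E : Type*} [NormedAddCommGroup E] [NormedSpace ℝ E] [FiniteDimensional ℝ E]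
    (hE : Module.finrank ℝ E = 2 * m)
    {M : Type*} [TopologicalSpace M] [T2Space M] [SecondCountableTopology M] [ConnectedSpace M]
    [ChartedSpace E M] [IsManifold 𝓘(ℝ, E) ∞ M]
    [RiemannianBundle (fun x : M => TangentSpace 𝓘(ℝ, E) x)]
    [IsContMDiffRiemannianBundle 𝓘(ℝ, E) ∞ E (fun x : M => TangentSpace 𝓘(ℝ, E) x)]
    (K : KahlerMobility.KahlerStructure E M) (B : ℝ) (hB : K.IsCC B)
    (hA : ∃ A : K.Sol, 2 ≤ KahlerMobility.KahlerStructure.numNonconstEigenvalues A ∨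
      3 ≤ KahlerMobility.KahlerStructure.numConstEigenvalues A) :
    3 ≤ K.mobility := by
  by_contra hK
  obtain ⟨A, hA⟩ := hA
  suffices h : ∃ (a c : ℝ) (ρ : M → ℝ), (c = a ∨ ¬ ∃ t, ∀ x, ρ x = t) ∧
      ∀ i, KahlerMobility.KahlerStructure.eigenvalueFun A i = (fun _ => a) ∨
        KahlerMobility.KahlerStructure.eigenvalueFun A i = (fun _ => c) ∨
        KahlerMobility.KahlerStructure.eigenvalueFun A i = ρ by
    obtain ⟨a, c, ρ, hρ, h⟩ := h
    have := KahlerMobility.KahlerStructure.num_eigenvalues_lt hρ h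
    omega
  obtain ⟨A₀, Λ₀, μ, hA₀, hΛ₀, hμ, hmain, hd, hdμ, x₀, hx₀⟩ := hB
  obtain ⟨hAh, Λ, hΛ, hAΛ⟩ := A.2
  have hsol : K.IsSolution B A₀ Λ₀ μ := ⟨hA₀, hΛ₀, hμ, hmain, hd, hdμ⟩
  obtain ⟨a, b, c, hne, h1, h2⟩ := KahlerMobility.KahlerStructure.exists_linear_relation hK
    hA₀ hΛ₀ hmain hAh hΛ hAΛ
  have hc : c ≠ 0 := by
    rintro rfl
    have hb : b = 0 := by
      have := h2 x₀
      rw [zero_smul, add_zero] at this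
      exact (smul_eq_zero.1 this).resolve_right hx₀
    have ha : a = 0 := by
      have := h1 x₀ (Λ₀ x₀)
      rw [hb, zero_smul, zero_smul, add_zero, add_zero] at this
      exact (smul_eq_zero.1 this).resolve_right hx₀
    simp [ha, hb] at hne
  have h3 : ∀ (x : M) (v : TangentSpace 𝓘(ℝ, E) x),
      (A : KahlerMobility.EndField E M) x v = (-(a / c)) • v + (-(b / c)) • A₀ x v := by
    intro x v
    have h := congrArg (fun w => c⁻¹ • w) (h1 x v)
    simp only [smul_zero, smul_add, smul_smul, inv_mul_cancel₀ hc] at h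
    rw [← sub_eq_zero, ← h]
    module
  have h4 : ∀ x, Λ x = (-(b / c)) • Λ₀ x := by
    intro x
    have h := congrArg (fun w => c⁻¹ • w) (h2 x)
    simp only [smul_zero, smul_add, smul_smul, inv_mul_cancel₀ hc] at h
    rw [← sub_eq_zero, ← h]
    module
  by_cases hb : b = 0
  -- Here `A` is a multiple of the identity; the function `0` only fills the slot of ρ.
  · refine ⟨-(a / c), -(a / c), fun _ => 0, Or.inl rfl, fun i => Or.inl ?_⟩
    exact KahlerMobility.KahlerStructure.eigenvalueFun_eq_const
      (fun x v => by rw [h3, hb]; simp) i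
  · exact (hsol.smul_add_id hAh hAΛ hΛ h3 h4).exists_eigenvalueFun_eq A hK (by omega) (x₀ := x₀)
      (by rw [h4]; exact smul_ne_zero (neg_ne_zero.2 (div_ne_zero hb hc)) hx₀)
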